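/- Let $\mathbb{1}_{\mathbb{P}}$ be the indicator function of the primes, i.e. $\mathbb{1}_{\mathbb{P}}(n)=1$ if $n$ is prime and $\mathbb{1}_{\mathbb{P}}(n)=0$ otherwise, and let $f=\mathrm{id}*\mathbb{1}_{\mathbb{P}}$ be its Dirichlet convolution with the identity function $\mathrm{id}(n)=n$, i.e. $f(n)=\sum_{d\mid n}\frac{n}{d}\,\mathbb{1}_{\mathbb{P}}(d)=\sum_{p\mid n,\ p\text{ prime}}\frac{n}{p}$ for $n\ge 1$. Then the series $\sum_{m\ge 1}\frac{f(m)}{m^2(m+1)}$ converges and, as $x\to\infty$ through the real numbers, $$\sum_{n\le x}\frac{f([x/n])}{[x/n]}=x\sum_{m\ge 1}\frac{f(m)}{m^2(m+1)}+O\bigl(x^{1/3}\log x\bigr),$$ where $n$ runs over the positive integers up to $x$, $[t]$ denotes the integer part of $t$, and the implied constant is absolute. -/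

import Mathlib

open Filter Asymptotics

open Classical in
/-- The indicator function of the set of primes, as an arithmetic function. -/
noncomputable def primeIndicator : ArithmeticFunction ℝ :=
  ⟨fun n => if n.Prime then 1 else 0, if_neg Nat.not_prime_zero⟩

/-- The Dirichlet convolution of the identity function with the indicator of the primes. -/
noncomputable def idConvPrime : ArithmeticFunction ℝ :=
  (ArithmeticFunction.id : ArithmeticFunction ℝ) * primeIndicator

/-! Since `f(m)/m = ∑_{p ∣ m} 1/p`, the error term is linear in the indicators of the multiples of
each prime `p`, weighted by `1/p`. Primes above `x^{1/6}` leave a remainder of size `x^{-1/6}(1 +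
log m)`, for which the trivial bound `√x log x` already gives `x^{1/3} log x`.

For the multiples of a fixed `d`, split at `m₀ ≈ √x` as in the hyperbola method. Values `m < m₀` are
counted by differences of floors, and in the range `n ≤ x/m₀` divisibility by `d` is itself a
difference of floors. Each floor is its argument minus `1/2` minus the sawtooth; the smooth parts
cancel the main term up to `O(1)`. What remains is four sums of the sawtooth at `(x/d)/(n + θ) + c`
with `n ≪ √x` (`abs_floorSumError_multipleIndicator_le`).

Such sums are cut into dyadic blocks and turned into exponential sums, which van der Corput's second
derivative test bounds (`norm_sum_expTwoPiI_le_of_second_differences`, resting on Kusmin–Landau).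
The result is `log x · ((x/d)^{1/3} + x^{1/4} d^{1/2})`. Weighted by `1/p` and summed over `p ≤
x^{1/6}`, the first term gives a convergent series times `x^{1/3}`, the second gives `x^{1/4}
x^{1/12} = x^{1/3}`. -/

/-! ### The additive character and the Kusmin–Landau inequality. -/

/-- The additive character `t ↦ exp (2πit)`. -/
noncomputable def expTwoPiI (t : ℝ) : ℂ := Complex.exp ((2 * Real.pi * t : ℝ) * Complex.I)

lemma norm_expTwoPiI (t : ℝ) : ‖expTwoPiI t‖ = 1 := Complex.norm_exp_ofReal_mul_I _

lemma expTwoPiI_add (s t : ℝ) : expTwoPiI (s + t) = expTwoPiI s * expTwoPiI t := by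
  unfold expTwoPiI
  rw [← Complex.exp_add]
  congr 1
  push_cast
  ring

lemma expTwoPiI_intCast (n : ℤ) : expTwoPiI n = 1 := by
  unfold expTwoPiI
  rw [Complex.exp_eq_one_iff]
  exact ⟨n, by push_cast; ring⟩

lemma re_expTwoPiI (t : ℝ) : (expTwoPiI t).re = Real.cos (2 * Real.pi * t) :=
  Complex.exp_ofReal_mul_I_re _

/-- The real part is constant, so the variation of these weights in a summation by parts is half
that of the cotangent, which is monotone and therefore telescopes. -/
lemma expTwoPiI_sub_one_inv {t : ℝ} (h : Real.sin (Real.pi * t) ≠ 0) :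
    (expTwoPiI t - 1)⁻¹ = -(1 / 2) -
      ((Real.cos (Real.pi * t) / Real.sin (Real.pi * t) : ℝ) : ℂ) / 2 * Complex.I := by
  set a := Real.pi * t with ha
  have hE : expTwoPiI t - 1 = 2 * Complex.I * Real.sin a * (Real.cos a + Real.sin a * Complex.I) := by
    have : expTwoPiI t = (Real.cos a + Real.sin a * Complex.I) ^ 2 := by
      unfold expTwoPiI
      rw [Complex.ofReal_cos, Complex.ofReal_sin, ← Complex.exp_mul_I, ← Complex.exp_nat_mul]
      congr 1
      rw [ha]
      push_cast
      ring
    rw [this]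
    have h1 : (Real.cos a : ℂ) ^ 2 + (Real.sin a : ℂ) ^ 2 = 1 := by
      exact_mod_cast Real.cos_sq_add_sin_sq a
    linear_combination h1 - 2 * (Real.sin a : ℂ) ^ 2 * Complex.I_sq + (Real.sin a : ℂ) ^ 2 * Complex.I_sq
  have hs : (Real.sin a : ℂ) ≠ 0 := by exact_mod_cast h
  have h1 : (Real.cos a : ℂ) ^ 2 + (Real.sin a : ℂ) ^ 2 = 1 := by
    exact_mod_cast Real.cos_sq_add_sin_sq a
  rw [hE]
  apply inv_eq_of_mul_eq_one_right
  push_cast [-Complex.ofReal_cos, -Complex.ofReal_sin]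
  field_simp
  linear_combination h1 +
    (-((Real.cos a : ℂ) ^ 2) - (Real.sin a : ℂ) * Real.cos a * Complex.I - (Real.sin a : ℂ) ^ 2
     ) * Complex.I_sq

/-- Jordan's inequality on `[0, π/2]`, reflected about `t = 1/2`. -/
lemma two_mul_le_sin_pi_mul {t δ : ℝ} (h0 : 0 ≤ δ) (h1 : δ ≤ t) (h2 : t ≤ 1 - δ) :
    2 * δ ≤ Real.sin (Real.pi * t) := by
  have hp := Real.pi_pos
  rcases le_total t (1 / 2) with h | h
  · have := Real.mul_le_sin (x := Real.pi * t) (by nlinarith) (by nlinarith)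
    have e : 2 / Real.pi * (Real.pi * t) = 2 * t := by field_simp
    linarith
  · have := Real.mul_le_sin (x := Real.pi * (1 - t)) (by nlinarith) (by nlinarith)
    have e : 2 / Real.pi * (Real.pi * (1 - t)) = 2 * (1 - t) := by field_simp
    have e2 : Real.sin (Real.pi * (1 - t)) = Real.sin (Real.pi * t) := by
      rw [mul_sub, mul_one, Real.sin_pi_sub]
    linarith

lemma cot_le_cot {a b : ℝ} (ha : 0 < Real.sin a) (hb : 0 < Real.sin b) (hab : a ≤ b)
    (hba : b ≤ a + Real.pi) : Real.cos b / Real.sin b ≤ Real.cos a / Real.sin a := by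
  rw [div_le_div_iff₀ hb ha]
  have := Real.sin_nonneg_of_nonneg_of_le_pi (x := b - a) (by linarith) (by linarith)
  rw [Real.sin_sub] at this
  linarith

/-- The Kusmin–Landau inequality, in discrete form. -/
theorem norm_sum_expTwoPiI_le_of_differences {u : ℕ → ℝ} {δ : ℝ} (hδ : 0 < δ) {a b : ℕ}
    (hmono : ∀ n, a ≤ n → n + 1 < b → u (n + 1) - u n ≤ u (n + 2) - u (n + 1))
    (hlo : ∀ n ∈ Finset.Ico a b, δ ≤ u (n + 1) - u n)
    (hhi : ∀ n ∈ Finset.Ico a b, u (n + 1) - u n ≤ 1 - δ) :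
    ‖∑ n ∈ Finset.Ico a b, expTwoPiI (u n)‖ ≤ 1 / δ := by
  rcases le_or_gt b a with hba | hab
  · rw [Finset.Ico_eq_empty (by omega)]
    simp only [Finset.sum_empty, norm_zero]
    positivity
  set g : ℕ → ℝ := fun n => u (n + 1) - u n with hg
  set cot : ℕ → ℝ := fun n => Real.cos (Real.pi * g n) / Real.sin (Real.pi * g n) with hcot
  set w : ℕ → ℂ := fun n => (expTwoPiI (g n) - 1)⁻¹ with hw
  have hsin : ∀ n ∈ Finset.Ico a b, 2 * δ ≤ Real.sin (Real.pi * g n) := fun n hn =>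
    two_mul_le_sin_pi_mul hδ.le (hlo n hn) (hhi n hn)
  have hweq : ∀ n ∈ Finset.Ico a b, w n = -(1 / 2) - (cot n : ℂ) / 2 * Complex.I := fun n hn =>
    expTwoPiI_sub_one_inv (by have := hsin n hn; exact (show 0 < Real.sin (Real.pi * g n) by linarith).ne')
  have hstep : ∀ n ∈ Finset.Ico a b,
      expTwoPiI (u n) = (expTwoPiI (u (n + 1)) - expTwoPiI (u n)) * w n := by
    intro n hn
    have hne : expTwoPiI (g n) - 1 ≠ 0 := by
      intro h0
      have := hweq n hn
      simp only [hw, h0, inv_zero] at this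
      have := congrArg Complex.re this
      simp at this
    have : expTwoPiI (u (n + 1)) = expTwoPiI (u n) * expTwoPiI (g n) := by
      rw [← expTwoPiI_add]
      simp [hg]
    rw [this, hw]
    field_simp
  have hcotb : ∀ n ∈ Finset.Ico a b, |cot n| ≤ 1 / (2 * δ) := by
    intro n hn
    have h1 := hsin n hn
    rw [hcot, abs_div, abs_of_pos (a := Real.sin _) (by linarith)]
    exact div_le_div₀ zero_le_one (Real.abs_cos_le_one _) (by positivity) h1
  have hwb : ∀ n ∈ Finset.Ico a b, ‖w n‖ ≤ 1 / (4 * δ) := by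
    intro n hn
    have hs := hsin n hn
    have hs0 : 0 < Real.sin (Real.pi * g n) := by linarith
    have h1 : ‖w n‖ ^ 2 = (1 / (2 * Real.sin (Real.pi * g n))) ^ 2 := by
      rw [hweq n hn, Complex.sq_norm, Complex.normSq_apply]
      have hcs := Real.cos_sq_add_sin_sq (Real.pi * g n)
      have hc : cot n * Real.sin (Real.pi * g n) = Real.cos (Real.pi * g n) := by
        simp only [hcot]
        field_simp
      rw [← hc] at hcs
      generalize cot n = c at hcs
      norm_num
      field_simp
      linarith
    have h2 := (sq_eq_sq₀ (norm_nonneg _) (by positivity)).1 h1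
    rw [h2]
    apply one_div_le_one_div_of_le (by positivity)
    linarith
  -- Summation by parts via `hstep`: apart from the two boundary terms, what is left is a sum of
  -- unimodular numbers times `w n - w (n + 1)`, whose norms telescope to half a difference of
  -- cotangents.
  have key : ∀ k, a + 1 + k ≤ b → ‖(∑ n ∈ Finset.Ico a (a + 1 + k), expTwoPiI (u n))
      - expTwoPiI (u (a + 1 + k)) * w (a + k) + expTwoPiI (u a) * w a‖ ≤
        (cot a - cot (a + k)) / 2 := by
    intro k
    induction k with
    | zero =>
      intro h
      have := hstep a (by simp; omega)
      simp only [add_zero, Nat.Ico_succ_singleton, Finset.sum_singleton, sub_self, zero_div]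
      rw [norm_le_zero_iff]
      linear_combination this
    | succ k ih =>
      intro h
      have hih := ih (by omega)
      rw [show a + 1 + (k + 1) = (a + 1 + k) + 1 by ring, Finset.sum_Ico_succ_top (by omega)]
      have hs := hstep (a + 1 + k) (by simp; omega)
      have m1 : a + k ∈ Finset.Ico a b := by simp; omega
      have m2 : a + (k + 1) ∈ Finset.Ico a b := by simp; omega
      have e1 : a + 1 + k = a + (k + 1) := by ring
      have hdiff : ‖w (a + k) - w (a + (k + 1))‖ ≤ (cot (a + k) - cot (a + (k + 1))) / 2 := by
        rw [hweq _ m1, hweq _ m2]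
        have : (-(1 / 2) - (cot (a + k) : ℂ) / 2 * Complex.I -
            (-(1 / 2) - (cot (a + (k + 1)) : ℂ) / 2 * Complex.I)) =
            ((-((cot (a + k) - cot (a + (k + 1))) / 2) : ℝ) : ℂ) * Complex.I := by
          push_cast
          ring
        rw [this, norm_mul, Complex.norm_I, mul_one, Complex.norm_real, norm_neg, Real.norm_eq_abs,
          abs_of_nonneg]
        have hm := hmono (a + k) (by omega) (by omega)
        have h3 := hlo _ m1
        have h4 := hhi _ m2
        have := cot_le_cot (a := Real.pi * g (a + k)) (b := Real.pi * g (a + (k + 1)))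
          (by have := hsin _ m1; linarith) (by have := hsin _ m2; linarith)
          (mul_le_mul_of_nonneg_left hm Real.pi_pos.le)
          (by
            have : g (a + (k + 1)) ≤ g (a + k) + 1 := by
              have : δ ≤ g (a + k) := h3
              have : g (a + (k + 1)) ≤ 1 - δ := h4
              linarith
            nlinarith [Real.pi_pos])
        have : cot (a + (k + 1)) ≤ cot (a + k) := this
        linarith
      calc _ = ‖((∑ n ∈ Finset.Ico a (a + 1 + k), expTwoPiI (u n))
              - expTwoPiI (u (a + 1 + k)) * w (a + k) + expTwoPiI (u a) * w a)
              + expTwoPiI (u (a + 1 + k)) * (w (a + k) - w (a + (k + 1)))‖ := by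
            rw [← e1]
            congr 1
            linear_combination hs
        _ ≤ (cot a - cot (a + k)) / 2 + 1 * ((cot (a + k) - cot (a + (k + 1))) / 2) := by
            refine (norm_add_le _ _).trans (add_le_add hih ?_)
            rw [norm_mul, norm_expTwoPiI]
            gcongr
        _ = _ := by ring
  obtain ⟨k, rfl⟩ : ∃ k, b = a + 1 + k := ⟨b - (a + 1), by omega⟩
  have h0 := key k le_rfl
  have ma : a ∈ Finset.Ico a (a + 1 + k) := by simp; omega
  have mk : a + k ∈ Finset.Ico a (a + 1 + k) := by simp
  have c1 := (abs_le.1 (hcotb _ ma)).2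
  have c2 := (abs_le.1 (hcotb _ mk)).1
  have e : (∑ n ∈ Finset.Ico a (a + 1 + k), expTwoPiI (u n)) =
      ((∑ n ∈ Finset.Ico a (a + 1 + k), expTwoPiI (u n))
      - expTwoPiI (u (a + 1 + k)) * w (a + k) + expTwoPiI (u a) * w a)
      + expTwoPiI (u (a + 1 + k)) * w (a + k) - expTwoPiI (u a) * w a := by ring
  rw [e]
  -- The variation contributes `1 / (2δ)` and each boundary term `1 / (4δ)`.
  calc _ ≤ (cot a - cot (a + k)) / 2 + 1 / (4 * δ) + 1 / (4 * δ) := by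
        refine (norm_sub_le _ _).trans (add_le_add ((norm_add_le _ _).trans (add_le_add h0 ?_)) ?_)
        · rw [norm_mul, norm_expTwoPiI, one_mul]; exact hwb _ mk
        · rw [norm_mul, norm_expTwoPiI, one_mul]; exact hwb _ ma
    _ ≤ (1 / (2 * δ) + 1 / (2 * δ)) / 2 + 1 / (4 * δ) + 1 / (4 * δ) := by
        gcongr
        linarith
    _ = 1 / δ := by field_simp; norm_num

/-! ### Van der Corput's second derivative test. -/

lemma mul_sub_le_sub_of_forall_le {g : ℕ → ℝ} {l : ℝ} {a b : ℕ}
    (h : ∀ n, a ≤ n → n + 1 < b → l ≤ g (n + 1) - g n) {m n : ℕ} (ham : a ≤ m) (hmn : m ≤ n)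
    (hnb : n < b) : l * ((n : ℝ) - m) ≤ g n - g m := by
  induction n, hmn using Nat.le_induction with
  | base => simp
  | succ n hmn ih =>
    have h1 := ih (by omega)
    have h2 := h n (by omega) hnb
    push_cast
    linarith

/-- As `g` grows by at least `l` per step, indices whose values lie in a window of length `δ` span
at most `δ / l`. -/
lemma card_le_of_forall_le_sub {g : ℕ → ℝ} {l α δ : ℝ} (hl : 0 < l) (hδ : 0 ≤ δ) {a b : ℕ}
    (h : ∀ n, a ≤ n → n + 1 < b → l ≤ g (n + 1) - g n) {s : Finset ℕ} (hs : s ⊆ Finset.Ico a b)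
    (hlo : ∀ n ∈ s, α ≤ g n) (hhi : ∀ n ∈ s, g n ≤ α + δ) : (s.card : ℝ) ≤ δ / l + 1 := by
  rcases s.eq_empty_or_nonempty with rfl | hne
  · simp only [Finset.card_empty, Nat.cast_zero]
    positivity
  have h1 := s.min'_mem hne
  have h2 := s.max'_mem hne
  have hle := s.min'_le_max' hne
  set m := s.min' hne
  set M := s.max' hne
  have hsub : s ⊆ Finset.Icc m M := fun n hn =>
    Finset.mem_Icc.2 ⟨s.min'_le n hn, s.le_max' n hn⟩
  have hcard : s.card ≤ M - m + 1 := by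
    have := Finset.card_le_card hsub
    rw [Nat.card_Icc] at this
    omega
  have hcard' : (s.card : ℝ) ≤ (M : ℝ) - m + 1 := by
    rw [← Nat.cast_sub hle]
    exact_mod_cast hcard
  have hg := mul_sub_le_sub_of_forall_le h (Finset.mem_Ico.1 (hs h1)).1 hle
    (Finset.mem_Ico.1 (hs h2)).2
  have : (M : ℝ) - m ≤ δ / l := by
    rw [le_div_iff₀ hl]
    have := hlo m h1
    have := hhi M h2
    linarith
  linarith

lemma exists_filter_Ico_eq_Ico {a b : ℕ} (p : ℕ → Prop) [DecidablePred p]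
    (hp : ∀ i j k, a ≤ i → i ≤ j → j ≤ k → k < b → p i → p k → p j) :
    ∃ a' b', a ≤ a' ∧ b' ≤ b ∧ (Finset.Ico a b).filter p = Finset.Ico a' b' := by
  rcases ((Finset.Ico a b).filter p).eq_empty_or_nonempty with he | hne
  · exact ⟨b + a, b, by omega, le_rfl, by rw [he, Finset.Ico_eq_empty (by omega)]⟩
  have h1 := Finset.min'_mem _ hne
  have h2 := Finset.max'_mem _ hne
  set m := Finset.min' _ hne with hm
  set M := Finset.max' _ hne with hM
  simp only [Finset.mem_filter, Finset.mem_Ico] at h1 h2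
  refine ⟨m, M + 1, h1.1.1, by omega, ?_⟩
  ext n
  constructor
  · intro hn
    have := Finset.min'_le _ n hn
    have := Finset.le_max' _ n hn
    simp only [Finset.mem_Ico]
    omega
  · intro hn
    simp only [Finset.mem_Ico] at hn
    simp only [Finset.mem_filter, Finset.mem_Ico]
    exact ⟨⟨by omega, by omega⟩, hp m n M h1.1.1 hn.1 (by omega) h2.1.2 h1.2 h2.2⟩

lemma norm_sum_expTwoPiI_le_card (s : Finset ℕ) (u : ℕ → ℝ) :
    ‖∑ n ∈ s, expTwoPiI (u n)‖ ≤ s.card := by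
  refine (norm_sum_le _ _).trans ?_
  simp [norm_expTwoPiI]

/-- A fibre on which the first difference has a given integer part. -/
lemma norm_sum_fiber_le {u : ℕ → ℝ} {l δ : ℝ} (hl : 0 < l) (hδ : 0 < δ) {a b : ℕ}
    (h : ∀ n ∈ Finset.Ico a b, l ≤ u (n + 2) - 2 * u (n + 1) + u n) (ν : ℤ) :
    ‖∑ n ∈ (Finset.Ico a b).filter (fun n => ⌊u (n + 1) - u n⌋ = ν), expTwoPiI (u n)‖
      ≤ 2 * (δ / l + 1) + 1 / δ := by
  classical
  set g : ℕ → ℝ := fun n => u (n + 1) - u n with hg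
  have hgl : ∀ n, a ≤ n → n + 1 < b → l ≤ g (n + 1) - g n := by
    intro n h1 h2
    have := h n (Finset.mem_Ico.2 ⟨h1, by omega⟩)
    simp only [hg]
    linarith
  have hgm : ∀ m n, a ≤ m → m ≤ n → n < b → g m ≤ g n := by
    intro m n h1 h2 h3
    have := mul_sub_le_sub_of_forall_le hgl h1 h2 h3
    have : (m : ℝ) ≤ n := by exact_mod_cast h2
    nlinarith
  set S := (Finset.Ico a b).filter (fun n => ⌊g n⌋ = ν) with hS
  have hSb : ∀ n ∈ S, (ν : ℝ) ≤ g n ∧ g n < ν + 1 := by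
    intro n hn
    rw [hS, Finset.mem_filter, Int.floor_eq_iff] at hn
    exact hn.2
  have hSs : S ⊆ Finset.Ico a b := Finset.filter_subset _ _
  -- Differences within `δ` of an integer are too close for Kusmin–Landau; they occur in two short
  -- ranges that are counted trivially. The rest is an interval, because `g` is monotone.
  set P : ℕ → Prop := fun n => ν + δ ≤ g n ∧ g n ≤ ν + 1 - δ with hP
  rw [← Finset.sum_filter_add_sum_filter_not S P,
    ← Finset.sum_filter_add_sum_filter_not (S.filter (fun n => ¬ P n)) (fun n => g n < ν + δ)]
  have hlow : ‖∑ n ∈ (S.filter (fun n => ¬ P n)).filter (fun n => g n < ν + δ),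
      expTwoPiI (u n)‖ ≤ δ / l + 1 := by
    refine (norm_sum_expTwoPiI_le_card _ _).trans
      (card_le_of_forall_le_sub (α := ν) hl hδ.le hgl
        ((Finset.filter_subset _ _).trans ((Finset.filter_subset _ _).trans hSs)) ?_ ?_)
    · intro n hn
      exact (hSb n (Finset.mem_of_mem_filter _ (Finset.mem_of_mem_filter _ hn))).1
    · intro n hn
      exact (Finset.mem_filter.1 hn).2.le
  have hhigh : ‖∑ n ∈ (S.filter (fun n => ¬ P n)).filter (fun n => ¬ (g n < ν + δ)),
      expTwoPiI (u n)‖ ≤ δ / l + 1 := by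
    refine (norm_sum_expTwoPiI_le_card _ _).trans
      (card_le_of_forall_le_sub (α := ν + 1 - δ) hl hδ.le hgl
        ((Finset.filter_subset _ _).trans ((Finset.filter_subset _ _).trans hSs)) ?_ ?_)
    · intro n hn
      simp only [Finset.mem_filter, hP, not_and, not_lt, not_le] at hn
      exact (hn.1.2 hn.2).le
    · intro n hn
      have := (hSb n (Finset.mem_of_mem_filter _ (Finset.mem_of_mem_filter _ hn))).2
      linarith
  have hmid : ‖∑ n ∈ S.filter P, expTwoPiI (u n)‖ ≤ 1 / δ := by
    have hSP : S.filter P = (Finset.Ico a b).filter (fun n => ⌊g n⌋ = ν ∧ P n) := by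
      rw [hS, Finset.filter_filter]
    obtain ⟨a', b', ha', hb', hE⟩ := exists_filter_Ico_eq_Ico (a := a) (b := b)
      (fun n => ⌊g n⌋ = ν ∧ P n) (by
        rintro i j k h1 h2 h3 h4 ⟨h5, h6⟩ ⟨h7, h8⟩
        have q1 := hgm i j h1 h2 (by omega)
        have q2 := hgm j k (by omega) h3 h4
        refine ⟨le_antisymm (h7 ▸ Int.floor_mono q2) (h5 ▸ Int.floor_mono q1), ?_, ?_⟩
        · exact h6.1.trans q1
        · exact q2.trans h8.2)
    rw [hSP, hE]
    have hmem : ∀ n ∈ Finset.Ico a' b', P n := by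
      intro n hn
      rw [← hE] at hn
      exact (Finset.mem_filter.1 hn).2.2
    -- Subtracting the integer `ν * n` does not change the exponential, and it moves the differences
    -- into `[δ, 1 - δ]`.
    have hsum : ∑ n ∈ Finset.Ico a' b', expTwoPiI (u n) =
        ∑ n ∈ Finset.Ico a' b', expTwoPiI (u n - ν * n) := by
      refine Finset.sum_congr rfl fun n _ => ?_
      have := expTwoPiI_add (u n - ν * n) ((ν * n : ℤ) : ℝ)
      rw [expTwoPiI_intCast, mul_one] at this
      rw [← this]
      push_cast
      ring_nf
    rw [hsum]
    apply norm_sum_expTwoPiI_le_of_differences hδ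
    · intro n h1 h2
      have := hgl n (by omega) (by omega)
      simp only [hg] at this
      push_cast
      linarith
    · intro n hn
      have := (hmem n hn).1
      simp only [hg] at this
      push_cast
      linarith
    · intro n hn
      have := (hmem n hn).2
      simp only [hg] at this
      push_cast
      linarith
  calc _ ≤ 1 / δ + ((δ / l + 1) + (δ / l + 1)) :=
        (norm_add_le _ _).trans (add_le_add hmid ((norm_add_le _ _).trans (add_le_add hlow hhigh)))
    _ = _ := by ring

/-- Van der Corput's second derivative test, in discrete form. -/
theorem norm_sum_expTwoPiI_le_of_second_differences {u : ℕ → ℝ} {l c : ℝ} (hl : 0 < l)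
    (hc : 1 ≤ c) {a b : ℕ} (hab : a ≤ b)
    (hlo : ∀ n ∈ Finset.Ico a b, l ≤ u (n + 2) - 2 * u (n + 1) + u n)
    (hhi : ∀ n ∈ Finset.Ico a b, u (n + 2) - 2 * u (n + 1) + u n ≤ c * l) :
    ‖∑ n ∈ Finset.Ico a b, expTwoPiI (u n)‖ ≤
      10 * c * (((b : ℝ) - a) * √l + 1 / √l) := by
  have hba : (0 : ℝ) ≤ (b : ℝ) - a := sub_nonneg.2 (by exact_mod_cast hab)
  have hs : 0 < √l := Real.sqrt_pos.2 hl
  -- For `l ≥ 1` the claim is weaker than the trivial bound `b - a`.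
  rcases le_or_gt 1 l with h1 | h1
  · refine (norm_sum_expTwoPiI_le_card _ _).trans ?_
    rw [Nat.card_Ico, Nat.cast_sub hab]
    have h2 : 1 ≤ √l := Real.one_le_sqrt.2 h1
    have h3 : (b : ℝ) - a ≤ ((b : ℝ) - a) * √l := le_mul_of_one_le_right hba h2
    have h4 : 0 < 1 / √l := by positivity
    nlinarith
  rcases hab.eq_or_lt with rfl | hlt
  · simp only [Finset.Ico_self, Finset.sum_empty, norm_zero]
    positivity
  set g : ℕ → ℝ := fun n => u (n + 1) - u n with hg
  have hgl : ∀ n, a ≤ n → n + 1 < b → l ≤ g (n + 1) - g n := by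
    intro n h1 h2
    have := hlo n (Finset.mem_Ico.2 ⟨h1, by omega⟩)
    simp only [hg]
    linarith
  have hgu : ∀ n, a ≤ n → n + 1 < b → -(c * l) ≤ (fun n => - g n) (n + 1) - (fun n => -g n) n := by
    intro n h1 h2
    have := hhi n (Finset.mem_Ico.2 ⟨h1, by omega⟩)
    simp only [hg]
    linarith
  have hgm : ∀ m n, a ≤ m → m ≤ n → n < b → g m ≤ g n := by
    intro m n h1 h2 h3
    have := mul_sub_le_sub_of_forall_le hgl h1 h2 h3
    have : (m : ℝ) ≤ n := by exact_mod_cast h2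
    nlinarith
  have hmaps : ∀ n ∈ Finset.Ico a b, ⌊g n⌋ ∈ Finset.Icc ⌊g a⌋ ⌊g (b - 1)⌋ := by
    intro n hn
    rw [Finset.mem_Ico] at hn
    exact Finset.mem_Icc.2 ⟨Int.floor_mono (hgm a n le_rfl hn.1 hn.2),
      Int.floor_mono (hgm n (b - 1) hn.1 (by omega) (by omega))⟩
  rw [← Finset.sum_fiberwise_of_maps_to hmaps]
  have hcard : ((Finset.Icc ⌊g a⌋ ⌊g (b - 1)⌋).card : ℝ) ≤ c * l * ((b : ℝ) - a) + 2 := by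
    have h0 : ⌊g a⌋ ≤ ⌊g (b - 1)⌋ := Int.floor_mono (hgm a (b - 1) le_rfl (by omega) (by omega))
    rw [Int.card_Icc]
    have h3 : (((⌊g (b - 1)⌋ + 1 - ⌊g a⌋).toNat : ℤ) : ℝ) = (⌊g (b - 1)⌋ : ℝ) + 1 - ⌊g a⌋ := by
      rw [Int.toNat_of_nonneg (by omega)]
      push_cast
      ring
    have h4 := mul_sub_le_sub_of_forall_le (g := fun n => -g n) hgu le_rfl (show a ≤ b - 1 by omega) (show b - 1 < b by omega)
    have h5 : ((b - 1 : ℕ) : ℝ) = (b : ℝ) - 1 := by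
      rw [Nat.cast_sub (by omega), Nat.cast_one]
    rw [h5] at h4
    have h6 := Int.floor_le (g (b - 1))
    have h7 := Int.lt_floor_add_one (g a)
    rw [Int.cast_natCast] at h3
    rw [h3]
    have h8 : 0 ≤ c * l := by positivity
    nlinarith
  -- The choice `δ = √l` balances `δ / l` against `1 / δ`; the two leftover units are absorbed since
  -- `l < 1`.
  have hfib : ∀ ν ∈ Finset.Icc ⌊g a⌋ ⌊g (b - 1)⌋,
      ‖∑ n ∈ (Finset.Ico a b).filter (fun n => ⌊g n⌋ = ν), expTwoPiI (u n)‖ ≤ 5 / √l := by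
    intro ν _
    refine (norm_sum_fiber_le hl hs hlo ν).trans ?_
    have h3 : √l / l = 1 / √l := by
      rw [div_eq_div_iff hl.ne' hs.ne', Real.mul_self_sqrt hl.le, one_mul]
    have h4 : 1 ≤ 1 / √l := by
      rw [le_div_iff₀ hs, one_mul]
      exact Real.sqrt_le_one.2 h1.le
    rw [h3]
    have : 5 / √l = 5 * (1 / √l) := by ring
    linarith
  refine (norm_sum_le _ _).trans ((Finset.sum_le_card_nsmul _ _ _ hfib).trans ?_)
  rw [nsmul_eq_mul]
  calc _ ≤ (c * l * ((b : ℝ) - a) + 2) * (5 / √l) := by gcongr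
    _ = 5 * c * (((b : ℝ) - a) * √l) + 10 / √l := by
        nth_rewrite 1 [← Real.mul_self_sqrt hl.le]
        field_simp
        ring
    _ ≤ _ := by
        have : 0 ≤ ((b : ℝ) - a) * √l := by positivity
        have h4 : 0 < 1 / √l := by positivity
        have h5 : 10 / √l = 10 * (1 / √l) := by ring
        rw [h5]
        nlinarith [mul_nonneg (sub_nonneg.2 hc) this, mul_nonneg (sub_nonneg.2 hc) h4.le]

/-! ### From exponential sums to sawtooth sums. -/

/-- The sawtooth function `t ↦ {t} - 1/2`. -/
noncomputable def sawtooth (t : ℝ) : ℝ := Int.fract t - 1 / 2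

/-- The periodic second Bernoulli function. -/
noncomputable def periodicBernoulliTwo (t : ℝ) : ℝ := Int.fract t ^ 2 - Int.fract t + 1 / 6

lemma abs_sawtooth_le (t : ℝ) : |sawtooth t| ≤ 1 / 2 := by
  have h1 := Int.fract_nonneg t
  have h2 := Int.fract_lt_one t
  rw [sawtooth, abs_le]
  constructor <;> linarith

/-- The Fourier series on `[0, 1]`, evaluated at the fractional part. Its term at `h = 0` vanishes
because `1 / 0 = 0`. -/
lemma hasSum_cos_div_sq (t : ℝ) :
    HasSum (fun h : ℕ => 1 / (h : ℝ) ^ 2 * Real.cos (2 * Real.pi * (h * t)))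
      (Real.pi ^ 2 * periodicBernoulliTwo t) := by
  have h0 := hasSum_one_div_nat_pow_mul_cos (k := 1) one_ne_zero (x := Int.fract t)
    ⟨Int.fract_nonneg t, (Int.fract_lt_one t).le⟩
  have hB : (Polynomial.map (algebraMap ℚ ℝ) (Polynomial.bernoulli 2)).eval (Int.fract t) =
      Int.fract t ^ 2 - Int.fract t + 1 / 6 := by
    simp [Polynomial.bernoulli, Finset.sum_range_succ, Polynomial.eval_add,
      Polynomial.eval_monomial, bernoulli_two, Polynomial.map_add]
    ring
  convert h0 using 1
  · funext h
    simp only [mul_one]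
    congr 1
    have : 2 * Real.pi * (h * t) = 2 * Real.pi * h * Int.fract t + (h * ⌊t⌋ : ℤ) * (2 * Real.pi) := by
      have := Int.floor_add_fract t
      push_cast
      linear_combination (-2 * Real.pi * h) * this
    rw [this, Real.cos_add_int_mul_two_pi]
  · simp only [mul_one]
    rw [hB, periodicBernoulliTwo, show ((Nat.factorial 2 : ℕ) : ℝ) = 2 by norm_num [Nat.factorial]]
    ring

lemma fract_sub_cases {t δ : ℝ} (h0 : 0 ≤ δ) (h1 : δ ≤ 1) :
    (δ ≤ Int.fract t ∧ Int.fract (t - δ) = Int.fract t - δ) ∨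
      (Int.fract t < δ ∧ Int.fract (t - δ) = Int.fract t - δ + 1) := by
  have h2 := Int.fract_nonneg t
  have h3 := Int.fract_lt_one t
  have h4 := Int.floor_add_fract t
  rcases le_or_gt δ (Int.fract t) with h | h
  · refine Or.inl ⟨h, ?_⟩
    rw [Int.fract_eq_iff]
    exact ⟨by linarith, by linarith, ⌊t⌋, by linarith⟩
  · refine Or.inr ⟨h, ?_⟩
    rw [Int.fract_eq_iff]
    exact ⟨by linarith, by linarith, ⌊t⌋ - 1, by push_cast; linarith⟩

/-- The quotient is the mean of the sawtooth over `[t - δ, t]`. The sawtooth has slope one and only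
jumps downwards, so at `v` in this interval it is at least its value at `t` minus `t - v`; averaging
costs `δ / 2`. This replaces the sawtooth by a function with an absolutely convergent Fourier
series. -/
lemma sawtooth_le_smooth {t δ : ℝ} (h0 : 0 < δ) (h1 : δ ≤ 1) :
    sawtooth t ≤ (periodicBernoulliTwo t - periodicBernoulliTwo (t - δ)) / (2 * δ) + δ / 2 := by
  rw [← sub_le_iff_le_add, le_div_iff₀ (by positivity), sawtooth, periodicBernoulliTwo,
    periodicBernoulliTwo]
  rcases fract_sub_cases (t := t) h0.le h1 with ⟨h, h'⟩ | ⟨h, h'⟩ <;> rw [h'] <;> nlinarith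

lemma smooth_le_sawtooth {t δ : ℝ} (h0 : 0 < δ) (h1 : δ ≤ 1) :
    (periodicBernoulliTwo (t + δ) - periodicBernoulliTwo t) / (2 * δ) - δ / 2 ≤ sawtooth t := by
  rw [sub_le_iff_le_add, div_le_iff₀ (by positivity), sawtooth, periodicBernoulliTwo,
    periodicBernoulliTwo]
  have h2 := Int.fract_nonneg (t + δ)
  have h3 := Int.fract_lt_one (t + δ)
  have := fract_sub_cases (t := t + δ) h0.le h1
  rw [add_sub_cancel_right] at this
  rcases this with ⟨h, h'⟩ | ⟨h, h'⟩ <;> rw [h'] <;> nlinarith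

lemma norm_expTwoPiI_sub_one_le (t : ℝ) : ‖expTwoPiI t - 1‖ ≤ 7 * min 1 |t| := by
  rcases le_total 1 |t| with h | h
  · rw [min_eq_left h]
    refine (norm_sub_le _ _).trans ?_
    rw [norm_expTwoPiI, norm_one]
    norm_num
  · rw [min_eq_right h, expTwoPiI, mul_comm]
    refine (Real.norm_exp_I_mul_ofReal_sub_one_le).trans ?_
    rw [Real.norm_eq_abs, abs_mul, abs_of_pos Real.two_pi_pos]
    have := Real.pi_lt_d2
    gcongr
    linarith

lemma inv_sqrt_succ_le (M : ℕ) : 1 / √((M : ℝ) + 1) ≤ 2 * (√((M : ℝ) + 1) - √M) := by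
  have h1 : 0 < √((M : ℝ) + 1) := by positivity
  have h2 := Real.sqrt_nonneg (M : ℝ)
  have h3 := Real.sq_sqrt (show (0 : ℝ) ≤ M by positivity)
  have h4 := Real.sq_sqrt (show (0 : ℝ) ≤ (M : ℝ) + 1 by positivity)
  rw [div_le_iff₀ h1]
  nlinarith [sq_nonneg (√((M : ℝ) + 1) - √M)]

lemma sum_inv_sqrt_le (M : ℕ) : ∑ h ∈ Finset.range M, 1 / √((h : ℝ) + 1) ≤ 2 * √M := by
  induction M with
  | zero => simp
  | succ M ih =>
    rw [Finset.sum_range_succ]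
    have := inv_sqrt_succ_le M
    push_cast
    linarith

lemma inv_mul_sqrt_succ_le {M : ℕ} (hM : 1 ≤ M) :
    1 / (((M : ℝ) + 1) * √((M : ℝ) + 1)) ≤ 2 / √M - 2 / √((M : ℝ) + 1) := by
  have hM' : (0 : ℝ) < M := by exact_mod_cast hM
  have h1 : 0 < √((M : ℝ) + 1) := by positivity
  have h2 : 0 < √(M : ℝ) := by positivity
  have h3 := Real.sq_sqrt (show (0 : ℝ) ≤ M by positivity)
  have h4 := Real.sq_sqrt (show (0 : ℝ) ≤ (M : ℝ) + 1 by positivity)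
  have h5 : √(M : ℝ) ≤ √((M : ℝ) + 1) := Real.sqrt_le_sqrt (by linarith)
  have h6 := inv_sqrt_succ_le M
  have e1 : 1 / (((M : ℝ) + 1) * √((M : ℝ) + 1)) =
      1 / √((M : ℝ) + 1) / (√((M : ℝ) + 1) * √((M : ℝ) + 1)) := by
    rw [Real.mul_self_sqrt (by positivity)]
    field_simp
  have e2 : 2 / √(M : ℝ) - 2 / √((M : ℝ) + 1) =
      2 * (√((M : ℝ) + 1) - √M) / (√(M : ℝ) * √((M : ℝ) + 1)) := by
    field_simp
  rw [e1, e2]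
  have : 0 ≤ 1 / √((M : ℝ) + 1) := by positivity
  gcongr

/-- Up to `H` the terms are at most `h^{-1/2} / H`; beyond `H` they are at most `h^{-3/2}`,
dominated by a telescoping difference. Both ranges contribute `O(H^{-1/2})`. -/
lemma sum_min_div_le {H : ℕ} (hH : 1 ≤ H) (M : ℕ) :
    ∑ h ∈ Finset.range M, 1 / (((h : ℝ) + 1) * √((h : ℝ) + 1)) * min 1 (((h : ℝ) + 1) / H) ≤
      4 / √H := by
  have hH' : (0 : ℝ) < H := by exact_mod_cast hH
  have hs : √(H : ℝ) * √H = H := Real.mul_self_sqrt hH'.le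
  have hs0 : 0 < √(H : ℝ) := by positivity
  have hsmall : ∀ M ≤ H, ∑ h ∈ Finset.range M,
      1 / (((h : ℝ) + 1) * √((h : ℝ) + 1)) * min 1 (((h : ℝ) + 1) / H) ≤ 2 * √M / H := by
    intro M _
    calc _ ≤ ∑ h ∈ Finset.range M, 1 / √((h : ℝ) + 1) / H := by
          refine Finset.sum_le_sum fun h _ => ?_
          calc _ ≤ 1 / (((h : ℝ) + 1) * √((h : ℝ) + 1)) * (((h : ℝ) + 1) / H) := by
                gcongr
                exact min_le_right _ _
            _ = _ := by field_simp
      _ ≤ _ := by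
          rw [← Finset.sum_div]
          gcongr
          exact sum_inv_sqrt_le M
  have hbig : ∀ M ≥ H, ∑ h ∈ Finset.range M,
      1 / (((h : ℝ) + 1) * √((h : ℝ) + 1)) * min 1 (((h : ℝ) + 1) / H) ≤ 4 / √H - 2 / √M := by
    intro M hM
    induction M, hM using Nat.le_induction with
    | base =>
      refine (hsmall H le_rfl).trans (le_of_eq ?_)
      nth_rewrite 2 [← hs]
      field_simp
      norm_num
    | succ M hM ih =>
      rw [Finset.sum_range_succ]
      have h1 := inv_mul_sqrt_succ_le (hH.trans hM)
      have h2 : 1 / (((M : ℝ) + 1) * √((M : ℝ) + 1)) * min 1 (((M : ℝ) + 1) / H) ≤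
          1 / (((M : ℝ) + 1) * √((M : ℝ) + 1)) :=
        mul_le_of_le_one_right (by positivity) (min_le_left _ _)
      push_cast
      linarith
  rcases le_total H M with h | h
  · refine (hbig M h).trans ?_
    have : 0 ≤ 2 / √(M : ℝ) := by positivity
    linarith
  · refine (hsmall M h).trans ?_
    rw [div_le_div_iff₀ hH' hs0]
    have : √(M : ℝ) ≤ √H := Real.sqrt_le_sqrt (by exact_mod_cast h)
    nlinarith

lemma sum_inv_mul_sqrt_le (M : ℕ) :
    ∑ h ∈ Finset.range M, 1 / (((h : ℝ) + 1) * √((h : ℝ) + 1)) ≤ 4 := by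
  have := sum_min_div_le le_rfl M
  simp only [Nat.cast_one, Real.sqrt_one, div_one] at this
  refine le_trans (le_of_eq (Finset.sum_congr rfl fun h _ => ?_)) this
  rw [min_eq_left (by linarith [Nat.cast_nonneg (α := ℝ) h]), mul_one]

/-- Translation by `η` multiplies the `h`-th Fourier mode by `e(hη) - 1`, of size at most `7 min(1,
h/H)`. Together with the coefficient `1/h²` this makes the sum over `h` of the assumed bounds
converge. -/
lemma abs_sum_periodicBernoulliTwo_sub_le {s : Finset ℕ} {u : ℕ → ℝ} {A B : ℝ} (hA : 0 ≤ A)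
    (hB : 0 ≤ B)
    (hV : ∀ h : ℕ, 1 ≤ h → ‖∑ n ∈ s, expTwoPiI (h * u n)‖ ≤ A * √h + B / √h)
    {H : ℕ} (hH : 1 ≤ H) {η : ℝ} (hη : |η| = 1 / H) :
    |∑ n ∈ s, (periodicBernoulliTwo (u n + η) - periodicBernoulliTwo (u n))| ≤
      4 * (A / √H + B / H) := by
  have hH' : (0 : ℝ) < H := by exact_mod_cast hH
  have hsum : HasSum (fun h : ℕ => ∑ n ∈ s, (1 / (h : ℝ) ^ 2 * Real.cos (2 * Real.pi * (h * (u n + η)))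
      - 1 / (h : ℝ) ^ 2 * Real.cos (2 * Real.pi * (h * u n))))
      (∑ n ∈ s, (Real.pi ^ 2 * periodicBernoulliTwo (u n + η) -
        Real.pi ^ 2 * periodicBernoulliTwo (u n))) :=
    hasSum_sum fun n _ => (hasSum_cos_div_sq _).sub (hasSum_cos_div_sq _)
  simp only [← mul_sub, ← Finset.mul_sum] at hsum
  have hterm : ∀ h : ℕ, |1 / ((h + 1 : ℕ) : ℝ) ^ 2 * ∑ n ∈ s,
      (Real.cos (2 * Real.pi * ((h + 1 : ℕ) * (u n + η))) -
        Real.cos (2 * Real.pi * ((h + 1 : ℕ) * u n)))| ≤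
      7 * A * (1 / (((h : ℝ) + 1) * √((h : ℝ) + 1)) * min 1 (((h : ℝ) + 1) / H)) +
      7 * B / H * (1 / (((h : ℝ) + 1) * √((h : ℝ) + 1))) := by
    intro h
    have hv := hV (h + 1) (by omega)
    set k : ℝ := ((h + 1 : ℕ) : ℝ) with hk
    have hk1 : (h : ℝ) + 1 = k := by rw [hk]; push_cast; ring
    rw [hk1]
    have hk0 : 0 < k := by rw [← hk1]; positivity
    have hre : ∑ n ∈ s, (Real.cos (2 * Real.pi * (k * (u n + η))) -
        Real.cos (2 * Real.pi * (k * u n))) =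
        ((expTwoPiI (k * η) - 1) * ∑ n ∈ s, expTwoPiI (k * u n)).re := by
      rw [Finset.mul_sum, Complex.re_sum]
      refine Finset.sum_congr rfl fun n _ => ?_
      rw [sub_mul, ← expTwoPiI_add, one_mul, Complex.sub_re, re_expTwoPiI, re_expTwoPiI]
      ring_nf
    have h1 : ‖expTwoPiI (k * η) - 1‖ ≤ 7 * min 1 (k / H) := by
      have := norm_expTwoPiI_sub_one_le (k * η)
      rwa [abs_mul, hη, abs_of_pos hk0, mul_one_div] at this
    have hsk : √k * √k = k := Real.mul_self_sqrt hk0.le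
    have hsk0 : 0 < √k := by positivity
    rw [hre, abs_mul, abs_of_pos (by positivity : 0 < 1 / k ^ 2)]
    calc _ ≤ 1 / k ^ 2 * ((7 * min 1 (k / H)) * (A * √k + B / √k)) := by
          refine mul_le_mul_of_nonneg_left ((Complex.abs_re_le_norm _).trans ?_) (by positivity)
          rw [norm_mul]
          gcongr
      _ = 7 * A * (√k / k ^ 2 * min 1 (k / H)) + 7 * B * (1 / (k ^ 2 * √k)) * min 1 (k / H) := by
          field_simp
      -- In the `B` term the bound `k / H` suffices, as `∑ k^{-3/2}` converges.
      _ ≤ 7 * A * (√k / k ^ 2 * min 1 (k / H)) + 7 * B * (1 / (k ^ 2 * √k)) * (k / H) := by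
          gcongr
          exact min_le_right _ _
      _ = _ := by
          congr 1
          · congr 2
            nth_rewrite 2 [← hsk]
            rw [← hsk]
            rw [Real.sqrt_mul_self hsk0.le]
            field_simp
          · field_simp
  have hshift := (hasSum_nat_add_iff' 1).2 hsum
  simp only [Finset.range_one, Finset.sum_singleton, Nat.cast_zero, ne_eq, OfNat.ofNat_ne_zero,
    not_false_eq_true, zero_pow, div_zero, zero_mul, sub_zero] at hshift
  have hlim := hshift.tendsto_sum_nat.abs
  have hbd : |Real.pi ^ 2 * ∑ n ∈ s, (periodicBernoulliTwo (u n + η) - periodicBernoulliTwo (u n))| ≤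
      7 * A * (4 / √H) + 7 * B / H * 4 := by
    refine le_of_tendsto hlim (Eventually.of_forall fun M => ?_)
    refine (Finset.abs_sum_le_sum_abs _ _).trans ((Finset.sum_le_sum fun h _ => hterm h).trans ?_)
    rw [Finset.sum_add_distrib, ← Finset.mul_sum, ← Finset.mul_sum]
    gcongr
    · exact sum_min_div_le hH M
    · exact sum_inv_mul_sqrt_le M
  rw [abs_mul, abs_of_pos (by positivity : 0 < Real.pi ^ 2)] at hbd
  have hpi : 9 ≤ Real.pi ^ 2 := by nlinarith [Real.pi_gt_three]
  set T := |∑ n ∈ s, (periodicBernoulliTwo (u n + η) - periodicBernoulliTwo (u n))|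
  have hT : 0 ≤ T := abs_nonneg _
  -- The factor `28 / π²` is at most `4` because `π² ≥ 9`.
  have e : 7 * A * (4 / √H) + 7 * B / H * 4 = 28 * (A / √H + B / H) := by ring
  have h0 : 0 ≤ A / √H + B / H := by positivity
  nlinarith

/-- The one-sided smoothings at scale `δ = 1 / H` enclose each sawtooth value up to `δ / 2`, whence
the term `s.card / (2 * H)`; dividing by `2 * δ` multiplies the Bernoulli bound by `H / 2`. -/
theorem abs_sum_sawtooth_le_of_norm_sum_le {s : Finset ℕ} {u : ℕ → ℝ} {A B : ℝ} (hA : 0 ≤ A)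
    (hB : 0 ≤ B)
    (hV : ∀ h : ℕ, 1 ≤ h → ‖∑ n ∈ s, expTwoPiI (h * u n)‖ ≤ A * √h + B / √h)
    {H : ℕ} (hH : 1 ≤ H) :
    |∑ n ∈ s, sawtooth (u n)| ≤ s.card / (2 * H) + 2 * (A * √H + B) := by
  have hH' : (0 : ℝ) < H := by exact_mod_cast hH
  set δ : ℝ := 1 / H with hδ
  have hδ0 : 0 < δ := by positivity
  have hδ1 : δ ≤ 1 := by
    rw [hδ, div_le_one hH']
    exact_mod_cast hH
  have h1 := (abs_le.1 (abs_sum_periodicBernoulliTwo_sub_le hA hB hV hH (η := δ)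
    (abs_of_pos hδ0))).1
  have h2 := (abs_le.1 (abs_sum_periodicBernoulliTwo_sub_le hA hB hV hH (η := -δ)
    (by rw [abs_neg, abs_of_pos hδ0]))).1
  have e2 : 4 * (A / √H + B / H) / (2 * δ) = 2 * (A * √H + B) := by
    have hs : √(H : ℝ) * √H = H := Real.mul_self_sqrt hH'.le
    have hs0 : 0 < √(H : ℝ) := by positivity
    rw [hδ]
    field_simp
    linear_combination (-4 * A) * hs
  have e3 : (s.card : ℝ) * (δ / 2) = s.card / (2 * H) := by
    rw [hδ]
    field_simp
  rw [abs_le]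
  constructor
  · have : ∑ n ∈ s, ((periodicBernoulliTwo (u n + δ) - periodicBernoulliTwo (u n)) / (2 * δ) - δ / 2)
        ≤ ∑ n ∈ s, sawtooth (u n) := Finset.sum_le_sum fun n _ => smooth_le_sawtooth hδ0 hδ1
    rw [Finset.sum_sub_distrib, ← Finset.sum_div, Finset.sum_const, nsmul_eq_mul, e3] at this
    have h3 := div_le_div_of_nonneg_right h1 (by positivity : 0 ≤ 2 * δ)
    rw [neg_div, e2] at h3
    linarith
  · have : ∑ n ∈ s, sawtooth (u n) ≤ ∑ n ∈ s,
        ((periodicBernoulliTwo (u n) - periodicBernoulliTwo (u n - δ)) / (2 * δ) + δ / 2) :=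
      Finset.sum_le_sum fun n _ => sawtooth_le_smooth hδ0 hδ1
    rw [Finset.sum_add_distrib, ← Finset.sum_div, Finset.sum_const, nsmul_eq_mul, e3] at this
    have h3 := div_le_div_of_nonneg_right h2 (by positivity : 0 ≤ 2 * δ)
    rw [neg_div, e2] at h3
    have e4 : ∑ n ∈ s, (periodicBernoulliTwo (u n) - periodicBernoulliTwo (u n - δ)) =
        -∑ n ∈ s, (periodicBernoulliTwo (u n + -δ) - periodicBernoulliTwo (u n)) := by
      rw [← Finset.sum_neg_distrib]
      refine Finset.sum_congr rfl fun n _ => ?_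
      rw [sub_eq_add_neg (u n)]
      ring
    rw [e4, neg_div] at this
    linarith

/-! ### Sawtooth sums along a hyperbola. -/

lemma second_difference_div {y c t : ℝ} (ht : 0 < t) :
    (y / (t + 2) + c) - 2 * (y / (t + 1) + c) + (y / t + c) =
      2 * y / (t * (t + 1) * (t + 2)) := by
  field_simp
  ring

lemma norm_sum_expTwoPiI_div_le {y θ c : ℝ} (hy : 0 < y) (h0 : 0 ≤ θ) (h1 : θ ≤ 1) {K M : ℕ}
    (hK : 1 ≤ K) (hKM : K ≤ M) (hM : M ≤ 2 * K) {h : ℕ} (hh : 1 ≤ h) :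
    ‖∑ n ∈ Finset.Ico K M, expTwoPiI (h * (y / ((n : ℝ) + θ) + c))‖ ≤
      600 * K * √(y / (30 * K ^ 3)) * √h + 600 / √(y / (30 * K ^ 3)) / √h := by
  have hK' : (1 : ℝ) ≤ K := by exact_mod_cast hK
  have hh' : (1 : ℝ) ≤ h := by exact_mod_cast hh
  set l := y / (30 * (K : ℝ) ^ 3) with hl
  have hl0 : 0 < l := by positivity
  have hdiff : ∀ n ∈ Finset.Ico K M, (h * (y / (((n + 2 : ℕ) : ℝ) + θ) + c)) -
      2 * (h * (y / (((n + 1 : ℕ) : ℝ) + θ) + c)) + (h * (y / ((n : ℝ) + θ) + c)) =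
      h * (2 * y / (((n : ℝ) + θ) * ((n : ℝ) + θ + 1) * ((n : ℝ) + θ + 2))) := by
    intro n hn
    have hn' : (1 : ℝ) ≤ n := by exact_mod_cast hK.trans (Finset.mem_Ico.1 hn).1
    rw [← second_difference_div (c := c) (by linarith : 0 < (n : ℝ) + θ)]
    push_cast
    ring_nf
  have hrange : ∀ n ∈ Finset.Ico K M, (K : ℝ) ≤ (n : ℝ) + θ ∧ (n : ℝ) + θ ≤ 2 * K := by
    intro n hn
    rw [Finset.mem_Ico] at hn
    have e1 : (K : ℝ) ≤ n := by exact_mod_cast hn.1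
    have e2 : (n : ℝ) + 1 ≤ 2 * K := by exact_mod_cast (show n + 1 ≤ 2 * K by omega)
    constructor <;> linarith
  -- For `K ≤ t ≤ 2K` the product `t (t + 1) (t + 2)` lies between `K³` and `24K³`, so the second
  -- differences lie between `h l` and `60 h l`.
  have := norm_sum_expTwoPiI_le_of_second_differences
    (u := fun n : ℕ => h * (y / ((n : ℝ) + θ) + c)) (l := h * l) (c := 60) (by positivity)
    (by norm_num) hKM ?_ ?_
  · refine this.trans ?_
    rw [Real.sqrt_mul (by positivity)]
    have hMK : (M : ℝ) - K ≤ K := by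
      have : (M : ℝ) ≤ 2 * K := by exact_mod_cast hM
      linarith
    calc _ ≤ 10 * 60 * ((K : ℝ) * (√h * √l) + 1 / (√h * √l)) := by gcongr
      _ = _ := by
        have : 0 < √(h : ℝ) := by positivity
        have : 0 < √l := by positivity
        field_simp
        ring
  · intro n hn
    obtain ⟨r1, r2⟩ := hrange n hn
    have hpos : 0 < (n : ℝ) + θ := by linarith
    rw [hdiff n hn]
    gcongr
    rw [hl, div_le_div_iff₀ (by positivity) (by positivity)]
    have : ((n : ℝ) + θ) * ((n : ℝ) + θ + 1) * ((n : ℝ) + θ + 2) ≤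
        (2 * K) * (3 * K) * (4 * K) := by gcongr <;> linarith
    nlinarith [pow_pos (by linarith : (0 : ℝ) < K) 3]
  · intro n hn
    obtain ⟨r1, r2⟩ := hrange n hn
    have hpos : 0 < (n : ℝ) + θ := by linarith
    rw [hdiff n hn, mul_left_comm]
    gcongr
    have : (K : ℝ) * K * K ≤ ((n : ℝ) + θ) * ((n : ℝ) + θ + 1) * ((n : ℝ) + θ + 2) := by
      gcongr <;> linarith
    rw [hl, mul_div_assoc', div_le_div_iff₀ (by positivity) (by positivity)]
    nlinarith

lemma abs_sum_sawtooth_div_dyadic_le {y z θ c : ℝ} (hz : 0 < z) (hzy : z ^ 3 = y) (h0 : 0 ≤ θ)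
    (h1 : θ ≤ 1) {K M : ℕ} (hK : 1 ≤ K) (hKM : K ≤ M) (hM : M ≤ 2 * K) :
    |∑ n ∈ Finset.Ico K M, sawtooth (y / ((n : ℝ) + θ) + c)| ≤
      7300 * (z + √((K : ℝ) ^ 3 / y)) := by
  have hy : 0 < y := hzy ▸ pow_pos hz 3
  have hK' : (1 : ℝ) ≤ K := by exact_mod_cast hK
  have hcard : ((Finset.Ico K M).card : ℝ) ≤ K := by
    rw [Nat.card_Ico]
    exact_mod_cast (by omega : M - K ≤ K)
  have hr0 : 0 ≤ √((K : ℝ) ^ 3 / y) := Real.sqrt_nonneg _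
  rcases le_or_gt (K : ℝ) z with h | h
  · calc _ ≤ ∑ n ∈ Finset.Ico K M, (1 / 2 : ℝ) :=
          (Finset.abs_sum_le_sum_abs _ _).trans (Finset.sum_le_sum fun n _ => abs_sawtooth_le _)
      _ ≤ _ := by
          rw [Finset.sum_const, nsmul_eq_mul]
          linarith
  -- This `H` balances the smoothing loss `K / H` with `K √(l H)`: both have order `z = y^{1/3}`.
  -- For `K ≤ z` the trivial bound was enough.
  set H := ⌈(K : ℝ) / z⌉₊ with hH
  have hKz : 1 < (K : ℝ) / z := by rwa [one_lt_div hz]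
  have hH1 : (K : ℝ) / z ≤ H := Nat.le_ceil _
  have hH2 : (H : ℝ) ≤ 2 * (K / z) := by
    have := Nat.ceil_lt_add_one (by positivity : 0 ≤ (K : ℝ) / z)
    linarith
  have hH0 : 1 ≤ H := Nat.one_le_iff_ne_zero.2 (by
    intro h
    rw [h, Nat.cast_zero] at hH1
    linarith)
  have hH0' : (0 : ℝ) < H := by exact_mod_cast hH0
  set l := y / (30 * (K : ℝ) ^ 3) with hl
  have hl0 : 0 < l := by positivity
  have key := abs_sum_sawtooth_le_of_norm_sum_le (s := Finset.Ico K M)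
    (u := fun n : ℕ => y / ((n : ℝ) + θ) + c) (A := 600 * K * √l) (B := 600 / √l) (by positivity)
    (by positivity) (fun h hh => norm_sum_expTwoPiI_div_le hy h0 h1 hK hKM hM hh) hH0
  refine key.trans ?_
  have e1 : ((Finset.Ico K M).card : ℝ) / (2 * H) ≤ z := by
    rw [div_le_iff₀ (by positivity)]
    rw [div_le_iff₀ hz] at hH1
    nlinarith
  have e2 : K * √l * √H ≤ z := by
    rw [mul_assoc, ← Real.sqrt_mul hl0.le]
    have : l * H ≤ (z / K) ^ 2 := by
      calc l * H ≤ l * (2 * (K / z)) := by gcongr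
        _ = (z / K) ^ 2 / 15 := by
          rw [hl, ← hzy]
          field_simp
          norm_num
        _ ≤ (z / K) ^ 2 := div_le_self (by positivity) (by norm_num)
    calc K * √(l * H) ≤ K * √((z / K) ^ 2) := by gcongr
      _ = z := by
        rw [Real.sqrt_sq (by positivity)]
        field_simp
  have e3 : 1 / √l ≤ 6 * √((K : ℝ) ^ 3 / y) := by
    have : 6 * √((K : ℝ) ^ 3 / y) = √(36 * ((K : ℝ) ^ 3 / y)) := by
      rw [Real.sqrt_mul (by norm_num), show (36 : ℝ) = 6 ^ 2 by norm_num, Real.sqrt_sq (by norm_num)]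
    rw [this, one_div, ← Real.sqrt_inv]
    apply Real.sqrt_le_sqrt
    rw [hl, inv_div, mul_div_assoc']
    gcongr
    norm_num
  have e4 : 2 * (600 * K * √l * √H + 600 / √l) = 1200 * (K * √l * √H) + 1200 * (1 / √l) := by ring
  rw [e4]
  nlinarith

theorem abs_sum_sawtooth_div_le {y z θ c : ℝ} (hz : 0 < z) (hzy : z ^ 3 = y) (h0 : 0 ≤ θ)
    (h1 : θ ≤ 1) (M : ℕ) :
    |∑ n ∈ Finset.Ico 1 M, sawtooth (y / ((n : ℝ) + θ) + c)| ≤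
      Nat.clog 2 M * (7300 * (z + √((M : ℝ) ^ 3 / y))) := by
  have hy : 0 < y := hzy ▸ pow_pos hz 3
  induction M using Nat.strong_induction_on with
  | _ M ih =>
    rcases le_or_gt M 1 with hM | hM
    · rw [Finset.Ico_eq_empty (by omega)]
      simp only [Finset.sum_empty, abs_zero]
      positivity
    -- Rounding up ensures `M ≤ 2 * K` and matches the recursion of `Nat.clog`, which counts the
    -- dyadic blocks.
    set K := (M + 1) / 2 with hK
    have hKM : K < M := by omega
    have hclog : Nat.clog 2 M = Nat.clog 2 K + 1 := Nat.clog_of_two_le one_lt_two hM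
    rw [← Finset.sum_Ico_consecutive _ (show 1 ≤ K by omega) hKM.le, hclog]
    have hB : 7300 * (z + √((K : ℝ) ^ 3 / y)) ≤ 7300 * (z + √((M : ℝ) ^ 3 / y)) := by
      have : (K : ℝ) ≤ M := by exact_mod_cast hKM.le
      gcongr
    have i1 := ih K hKM
    have i2 := abs_sum_sawtooth_div_dyadic_le (c := c) hz hzy h0 h1 (show 1 ≤ K by omega) hKM.le
      (show M ≤ 2 * K by omega)
    have i3 : (Nat.clog 2 K : ℝ) * (7300 * (z + √((K : ℝ) ^ 3 / y))) ≤
        Nat.clog 2 K * (7300 * (z + √((M : ℝ) ^ 3 / y))) := by gcongr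
    refine (abs_add_le _ _).trans ?_
    push_cast
    linarith

/-! ### Floor sums, the hyperbola split and the trivial bound. -/

/-- The weight `1 / (m (m + 1))`: the length of the set of `t > 0` with `⌊1 / t⌋ = m`. -/
noncomputable def floorWeight (m : ℕ) : ℝ := 1 / ((m : ℝ) * ((m : ℝ) + 1))

/-- The difference between `∑_{n ≤ x} h ⌊x / n⌋` and its expected value. -/
noncomputable def floorSumError (x : ℝ) (h : ℕ → ℝ) : ℝ :=
  ∑ n ∈ Finset.Icc 1 ⌊x⌋₊, h ⌊x / (n : ℝ)⌋₊ - x * ∑' m : ℕ, h m * floorWeight m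

lemma floorWeight_nonneg (m : ℕ) : 0 ≤ floorWeight m := by
  unfold floorWeight
  positivity

lemma floorWeight_zero : floorWeight 0 = 0 := by simp [floorWeight]

lemma floorWeight_eq_sub {m : ℕ} (hm : 1 ≤ m) :
    floorWeight m = 1 / (m : ℝ) - 1 / ((m : ℝ) + 1) := by
  have : (0 : ℝ) < m := by exact_mod_cast hm
  unfold floorWeight
  field_simp
  ring

lemma floorWeight_succ_le {m : ℕ} (hm : 1 ≤ m) : floorWeight (m + 1) ≤ floorWeight m := by
  have : (0 : ℝ) < m := by exact_mod_cast hm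
  unfold floorWeight
  push_cast
  gcongr <;> linarith

lemma natFloor_eq_sub_sawtooth {t : ℝ} (ht : 0 ≤ t) : (⌊t⌋₊ : ℝ) = t - 1 / 2 - sawtooth t := by
  rw [natCast_floor_eq_intCast_floor ht, sawtooth, Int.fract]
  ring

/-- The `n` with `⌊x / n⌋ = m` are those with `x / (m + 1) < n ≤ x / m`; the sum is grouped by the
value `m`. -/
lemma sum_floor_div_eq {x : ℝ} (hx : 0 ≤ x) (h : ℕ → ℝ) {m₀ : ℕ} (hm : 1 ≤ m₀) :
    ∑ n ∈ Finset.Ico (⌊x / m₀⌋₊ + 1) (⌊x⌋₊ + 1), h ⌊x / (n : ℝ)⌋₊ =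
      ∑ m ∈ Finset.Ico 1 m₀, h m * ((⌊x / m⌋₊ : ℝ) - ⌊x / ((m : ℝ) + 1)⌋₊) := by
  induction m₀, hm using Nat.le_induction with
  | base => simp
  | succ m hm ih =>
    have hm' : (0 : ℝ) < m := by exact_mod_cast hm
    have hle : ⌊x / ((m : ℝ) + 1)⌋₊ ≤ ⌊x / m⌋₊ := by
      apply Nat.floor_mono
      gcongr
      linarith
    have hle' : ⌊x / m⌋₊ ≤ ⌊x⌋₊ := by
      apply Nat.floor_mono
      exact div_le_self hx (by exact_mod_cast hm)
    rw [Finset.sum_Ico_succ_top hm, ← ih]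
    push_cast
    rw [← Finset.sum_Ico_consecutive _ (show ⌊x / ((m : ℝ) + 1)⌋₊ + 1 ≤ ⌊x / m⌋₊ + 1 by omega)
      (show ⌊x / m⌋₊ + 1 ≤ ⌊x⌋₊ + 1 by omega), add_comm]
    congr 1
    have : ∀ n ∈ Finset.Ico (⌊x / ((m : ℝ) + 1)⌋₊ + 1) (⌊x / m⌋₊ + 1), h ⌊x / (n : ℝ)⌋₊ = h m := by
      intro n hn
      rw [Finset.mem_Ico] at hn
      have hn0 : (0 : ℝ) < n := by exact_mod_cast (by omega : 0 < n)
      have h1 : (n : ℝ) ≤ x / m := (Nat.le_floor_iff (by positivity)).1 (by omega)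
      have h2 : x / ((m : ℝ) + 1) < n := (Nat.floor_lt (by positivity)).1 (by omega)
      rw [le_div_iff₀ hm'] at h1
      rw [div_lt_iff₀ (by positivity)] at h2
      congr 1
      rw [Nat.floor_eq_iff (by positivity)]
      constructor
      · rw [le_div_iff₀ hn0]
        linarith
      · rw [div_lt_iff₀ hn0]
        linarith
    rw [Finset.sum_congr rfl this, Finset.sum_const, Nat.card_Ico, nsmul_eq_mul, mul_comm]
    congr 1
    rw [Nat.add_sub_add_right, Nat.cast_sub hle]

/-- The hyperbola decomposition of the error term. -/
lemma floorSumError_eq {x : ℝ} (hx : 0 ≤ x) {h : ℕ → ℝ}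
    (hs : Summable fun m => h m * floorWeight m) {m₀ : ℕ} (hm : 1 ≤ m₀) :
    floorSumError x h =
      ∑ m ∈ Finset.Ico 1 m₀, h m * (sawtooth (x / ((m : ℝ) + 1)) - sawtooth (x / m)) +
      (∑ n ∈ Finset.Ico 1 (⌊x / m₀⌋₊ + 1), h ⌊x / (n : ℝ)⌋₊ -
        x * ∑' m : ℕ, h (m + m₀) * floorWeight (m + m₀)) := by
  have h1 : ⌊x / m₀⌋₊ ≤ ⌊x⌋₊ := Nat.floor_mono (div_le_self hx (by exact_mod_cast hm))
  have hI : Finset.Icc 1 ⌊x⌋₊ = Finset.Ico 1 (⌊x⌋₊ + 1) := by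
    ext
    simp only [Finset.mem_Icc, Finset.mem_Ico]
    omega
  unfold floorSumError
  rw [hI, ← Finset.sum_Ico_consecutive _ (show 1 ≤ ⌊x / m₀⌋₊ + 1 by omega)
    (show ⌊x / m₀⌋₊ + 1 ≤ ⌊x⌋₊ + 1 by omega), sum_floor_div_eq hx h hm,
    ← hs.sum_add_tsum_nat_add m₀, Finset.range_eq_Ico,
    Finset.sum_eq_sum_Ico_succ_bot (by omega : 0 < m₀), floorWeight_zero, mul_zero, zero_add]
  -- The smooth part of the floors is `x * floorWeight m`, which cancels the head of the series.
  have h2 : ∀ m ∈ Finset.Ico 1 m₀, h m * ((⌊x / m⌋₊ : ℝ) - ⌊x / ((m : ℝ) + 1)⌋₊) =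
      h m * (sawtooth (x / ((m : ℝ) + 1)) - sawtooth (x / m)) + x * (h m * floorWeight m) := by
    intro m hm
    rw [natFloor_eq_sub_sawtooth (by positivity), natFloor_eq_sub_sawtooth (by positivity),
      floorWeight_eq_sub (Finset.mem_Ico.1 hm).1]
    ring
  rw [Finset.sum_congr rfl h2, Finset.sum_add_distrib, ← Finset.mul_sum]
  ring

/-- A discrete form of `-((2 + log t) / t)' = (1 + log t) / t²`, giving a telescoping majorant for
the tails. -/
lemma log_mul_floorWeight_le {m : ℕ} (hm : 1 ≤ m) :
    (1 + Real.log m) * floorWeight m ≤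
      (2 + Real.log m) / m - (2 + Real.log (m + 1 : ℕ)) / (m + 1 : ℕ) := by
  have hm' : (0 : ℝ) < m := by exact_mod_cast hm
  have h1 : Real.log ((m : ℝ) + 1) - Real.log m ≤ 1 / m := by
    rw [← Real.log_div (by positivity) (by positivity)]
    refine (Real.log_le_sub_one_of_pos (by positivity)).trans (le_of_eq ?_)
    field_simp
    ring
  unfold floorWeight
  push_cast
  have h2 : Real.log ((m : ℝ) + 1) ≤ Real.log m + 1 / m := by linarith
  have h3 : (2 + Real.log ((m : ℝ) + 1)) / ((m : ℝ) + 1) ≤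
      (2 + (Real.log m + 1 / m)) / ((m : ℝ) + 1) := by gcongr
  refine le_trans (le_of_eq ?_) (sub_le_sub_left h3 _)
  field_simp
  ring

lemma sum_log_mul_floorWeight_le {m₀ : ℕ} (hm : 1 ≤ m₀) (M : ℕ) :
    ∑ i ∈ Finset.range M, (1 + Real.log (i + m₀ : ℕ)) * floorWeight (i + m₀) ≤
      (2 + Real.log m₀) / m₀ := by
  have : ∑ i ∈ Finset.range M, (1 + Real.log (i + m₀ : ℕ)) * floorWeight (i + m₀) ≤
      (2 + Real.log m₀) / m₀ - (2 + Real.log (M + m₀ : ℕ)) / (M + m₀ : ℕ) := by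
    induction M with
    | zero => simp
    | succ M ih =>
      rw [Finset.sum_range_succ]
      have := log_mul_floorWeight_le (show 1 ≤ M + m₀ by omega)
      rw [show M + 1 + m₀ = M + m₀ + 1 by ring]
      linarith
  refine this.trans (sub_le_self _ ?_)
  have := Real.log_natCast_nonneg (M + m₀)
  positivity

lemma summable_tail_of_le_log {h : ℕ → ℝ} {B : ℝ} (hB : 0 ≤ B)
    (hh : ∀ m, 1 ≤ m → |h m| ≤ B * (1 + Real.log m)) {m₀ : ℕ} (hm : 1 ≤ m₀) :
    Summable (fun i => h (i + m₀) * floorWeight (i + m₀)) ∧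
      |∑' i, h (i + m₀) * floorWeight (i + m₀)| ≤ B * ((2 + Real.log m₀) / m₀) := by
  have hb : ∀ i, |h (i + m₀) * floorWeight (i + m₀)| ≤
      B * ((1 + Real.log (i + m₀ : ℕ)) * floorWeight (i + m₀)) := by
    intro i
    rw [abs_mul, abs_of_nonneg (floorWeight_nonneg _), ← mul_assoc]
    exact mul_le_mul_of_nonneg_right (hh _ (by omega)) (floorWeight_nonneg _)
  have hnn : ∀ i : ℕ, 0 ≤ (1 + Real.log (i + m₀ : ℕ)) * floorWeight (i + m₀) := fun i =>
    mul_nonneg (by have := Real.log_natCast_nonneg (i + m₀); positivity) (floorWeight_nonneg _)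
  have hs := summable_of_sum_range_le hnn (sum_log_mul_floorWeight_le hm)
  have ht : ∑' i : ℕ, (1 + Real.log (i + m₀ : ℕ)) * floorWeight (i + m₀) ≤ (2 + Real.log m₀) / m₀ :=
    Real.tsum_le_of_sum_range_le hnn (sum_log_mul_floorWeight_le hm)
  refine ⟨Summable.of_norm_bounded (hs.mul_left B) hb, ?_⟩
  have := tsum_of_norm_bounded (f := fun i => h (i + m₀) * floorWeight (i + m₀)) (hs.mul_left B).hasSum hb
  rw [tsum_mul_left] at this
  exact this.trans (by gcongr)

lemma summable_of_le_log {h : ℕ → ℝ} {B : ℝ} (hB : 0 ≤ B)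
    (hh : ∀ m, 1 ≤ m → |h m| ≤ B * (1 + Real.log m)) :
    Summable (fun m => h m * floorWeight m) :=
  (summable_nat_add_iff 1).1 (summable_tail_of_le_log hB hh le_rfl).1

lemma ceil_sqrt_bounds {x : ℝ} (hx : 4 ≤ x) :
    √x ≤ ⌈√x⌉₊ ∧ (⌈√x⌉₊ : ℝ) ≤ 2 * √x ∧ 1 ≤ ⌈√x⌉₊ ∧ 2 * √x ≤ x ∧ 2 ≤ √x ∧
      ⌊x / ⌈√x⌉₊⌋₊ ≤ √x := by
  have h1 : 2 ≤ √x := by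
    rw [show (2 : ℝ) = √4 by rw [show (4 : ℝ) = 2 ^ 2 by norm_num, Real.sqrt_sq (by norm_num)]]
    exact Real.sqrt_le_sqrt hx
  have h2 := Nat.le_ceil (√x)
  have h3 := Nat.ceil_lt_add_one (Real.sqrt_nonneg x)
  have h4 := Real.mul_self_sqrt (show 0 ≤ x by linarith)
  have h5 : (0 : ℝ) < ⌈√x⌉₊ := by linarith
  refine ⟨h2, by linarith, by exact_mod_cast h5, by nlinarith, h1, ?_⟩
  refine (Nat.floor_le (by positivity)).trans ?_
  rw [div_le_iff₀ h5]
  nlinarith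

/-- The trivial bound for the error term. -/
lemma abs_floorSumError_le {x : ℝ} (hx : 4 ≤ x) {h : ℕ → ℝ} {B : ℝ} (hB : 0 ≤ B)
    (hh : ∀ m, 1 ≤ m → |h m| ≤ B * (1 + Real.log m)) :
    |floorSumError x h| ≤ 5 * B * √x * (2 + Real.log x) := by
  obtain ⟨h1, h2, h3, h4, h5, h6⟩ := ceil_sqrt_bounds hx
  set m₀ := ⌈√x⌉₊
  have hx0 : 0 < x := by linarith
  have hl : 0 ≤ Real.log x := Real.log_nonneg (by linarith)
  have hm0 : (0 : ℝ) < m₀ := by linarith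
  rw [floorSumError_eq hx0.le (summable_of_le_log hB hh) h3]
  have hlog : ∀ m : ℕ, 1 ≤ m → (m : ℝ) ≤ x → |h m| ≤ B * (2 + Real.log x) := by
    intro m hm hmx
    refine (hh m hm).trans ?_
    have : Real.log m ≤ Real.log x := Real.log_le_log (by exact_mod_cast hm) hmx
    gcongr
    linarith
  have b1 : |∑ m ∈ Finset.Ico 1 m₀, h m * (sawtooth (x / ((m : ℝ) + 1)) - sawtooth (x / m))| ≤
      2 * √x * (B * (2 + Real.log x)) := by
    calc _ ≤ ∑ m ∈ Finset.Ico 1 m₀, B * (2 + Real.log x) := by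
          refine (Finset.abs_sum_le_sum_abs _ _).trans (Finset.sum_le_sum fun m hm => ?_)
          rw [Finset.mem_Ico] at hm
          have e1 := hlog m hm.1 (by
            have : (m : ℝ) ≤ m₀ := by exact_mod_cast hm.2.le
            linarith)
          have e2 : |sawtooth (x / ((m : ℝ) + 1)) - sawtooth (x / m)| ≤ 1 := by
            have := abs_sawtooth_le (x / ((m : ℝ) + 1))
            have := abs_sawtooth_le (x / m)
            have := abs_sub (sawtooth (x / ((m : ℝ) + 1))) (sawtooth (x / m))
            linarith
          rw [abs_mul]
          exact (mul_le_of_le_one_right (abs_nonneg _) e2).trans e1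
      _ ≤ _ := by
          rw [Finset.sum_const, Nat.card_Ico, nsmul_eq_mul]
          have : ((m₀ - 1 : ℕ) : ℝ) ≤ m₀ := by exact_mod_cast Nat.sub_le _ _
          gcongr
          linarith
  have b2 : |∑ n ∈ Finset.Ico 1 (⌊x / m₀⌋₊ + 1), h ⌊x / (n : ℝ)⌋₊| ≤
      √x * (B * (2 + Real.log x)) := by
    calc _ ≤ ∑ n ∈ Finset.Ico 1 (⌊x / m₀⌋₊ + 1), B * (2 + Real.log x) := by
          refine (Finset.abs_sum_le_sum_abs _ _).trans (Finset.sum_le_sum fun n hn => ?_)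
          rw [Finset.mem_Ico] at hn
          have hn1 : (1 : ℝ) ≤ n := by exact_mod_cast hn.1
          have hn2 : (n : ℝ) ≤ √x := by
            have : (n : ℝ) ≤ ⌊x / m₀⌋₊ := by exact_mod_cast (by omega : n ≤ ⌊x / m₀⌋₊)
            linarith
          refine hlog _ ?_ ?_
          · rw [Nat.one_le_floor_iff, le_div_iff₀ (by linarith)]
            linarith
          · exact (Nat.floor_le (by positivity)).trans (div_le_self hx0.le hn1)
      _ ≤ _ := by
          rw [Finset.sum_const, Nat.card_Ico, nsmul_eq_mul, Nat.add_sub_cancel]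
          gcongr
  have b3 : |x * ∑' m : ℕ, h (m + m₀) * floorWeight (m + m₀)| ≤
      √x * (B * (2 + Real.log x)) := by
    rw [abs_mul, abs_of_pos hx0]
    have e1 := (summable_tail_of_le_log hB hh h3).2
    have e2 : Real.log m₀ ≤ Real.log x := Real.log_le_log hm0 (by linarith)
    have e3 : x / m₀ ≤ √x := by
      rw [div_le_iff₀ hm0]
      nlinarith [Real.mul_self_sqrt hx0.le]
    calc _ ≤ x * (B * ((2 + Real.log m₀) / m₀)) := by gcongr
      _ = (x / m₀) * (B * (2 + Real.log m₀)) := by ring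
      _ ≤ _ := by
        have := Real.log_natCast_nonneg m₀
        gcongr
  have t1 := abs_add_le (∑ m ∈ Finset.Ico 1 m₀, h m * (sawtooth (x / ((m : ℝ) + 1)) - sawtooth (x / m)))
    (∑ n ∈ Finset.Ico 1 (⌊x / m₀⌋₊ + 1), h ⌊x / (n : ℝ)⌋₊ -
        x * ∑' m : ℕ, h (m + m₀) * floorWeight (m + m₀))
  have t2 := abs_sub (∑ n ∈ Finset.Ico 1 (⌊x / m₀⌋₊ + 1), h ⌊x / (n : ℝ)⌋₊)
    (x * ∑' m : ℕ, h (m + m₀) * floorWeight (m + m₀))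
  have t3 : 0 ≤ √x * (B * (2 + Real.log x)) := by positivity
  linarith

/-! ### The error term for the multiples of `d`. -/

/-- The indicator function of the multiples of `d`. -/
noncomputable def multipleIndicator (d m : ℕ) : ℝ := if d ∣ m then 1 else 0

lemma abs_multipleIndicator_le (d m : ℕ) : |multipleIndicator d m| ≤ 1 := by
  unfold multipleIndicator
  split_ifs <;> simp

/-- With `a = ⌊t⌋ - 1`, divisibility of `a + 1` by `d` is detected by `⌊(a + 1) / d⌋ - ⌊a / d⌋`, and
the inner floors can be dropped. -/
lemma multipleIndicator_floor {t : ℝ} (ht : 1 ≤ t) (d : ℕ) :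
    multipleIndicator d ⌊t⌋₊ = 1 / d - sawtooth (t / d) + sawtooth ((t - 1) / d) := by
  obtain ⟨a, ha⟩ : ∃ a, ⌊t⌋₊ = a + 1 :=
    ⟨⌊t⌋₊ - 1, by have := (Nat.one_le_floor_iff t).2 ht; omega⟩
  have h1 : ⌊t - 1⌋₊ = a := by rw [Nat.floor_sub_one, ha, Nat.add_sub_cancel]
  have h2 := natFloor_eq_sub_sawtooth (t := t / d) (by positivity)
  have h3 := natFloor_eq_sub_sawtooth (t := (t - 1) / d) (div_nonneg (by linarith) (by positivity))
  rw [Nat.floor_div_natCast, ha, Nat.succ_div] at h2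
  rw [Nat.floor_div_natCast, h1] at h3
  rw [ha, multipleIndicator]
  push_cast at h2
  have h4 : (t - 1) / d = t / d - 1 / d := by ring
  split_ifs at h2 ⊢ <;> linarith

lemma sum_floorWeight {m₀ : ℕ} (hm : 1 ≤ m₀) (M : ℕ) :
    ∑ i ∈ Finset.range M, floorWeight (i + m₀) = 1 / (m₀ : ℝ) - 1 / ((M + m₀ : ℕ) : ℝ) := by
  induction M with
  | zero => simp
  | succ M ih =>
    rw [Finset.sum_range_succ, ih, floorWeight_eq_sub (by omega)]
    push_cast
    ring

/-- The indicator minus its density `1 / d` is the difference of a sequence bounded by `1 / 2`;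
partial summation against the decreasing weights, whose tail sums to `1 / m₀`, leaves only the first
weight. -/
lemma abs_tsum_multipleIndicator_sub_le (d : ℕ) {m₀ : ℕ} (hm : 1 ≤ m₀)
    (hs : Summable fun i => multipleIndicator d (i + m₀) * floorWeight (i + m₀)) :
    |∑' i, multipleIndicator d (i + m₀) * floorWeight (i + m₀) - 1 / (d : ℝ) * (1 / m₀)| ≤
      floorWeight m₀ := by
  set s : ℕ → ℝ := fun j => sawtooth (((j : ℝ) - 1) / d) with hsdef
  have hind : ∀ m, 1 ≤ m → multipleIndicator d m = 1 / d - s (m + 1) + s m := by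
    intro m hm
    have := multipleIndicator_floor (t := (m : ℝ)) (by exact_mod_cast hm) d
    rw [Nat.floor_natCast] at this
    rw [this, hsdef]
    push_cast
    rw [add_sub_cancel_right]
  have hsb : ∀ j, |s j| ≤ 1 / 2 := fun j => abs_sawtooth_le _
  have key : ∀ M, |∑ i ∈ Finset.range M, (s (i + m₀) - s (i + m₀ + 1)) * floorWeight (i + m₀) +
      s (M + m₀) * floorWeight (M + m₀)| ≤ floorWeight m₀ - floorWeight (M + m₀) / 2 := by
    intro M
    induction M with
    | zero =>
      rw [Finset.sum_range_zero, zero_add, zero_add, abs_mul, abs_of_nonneg (floorWeight_nonneg _)]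
      nlinarith [hsb m₀, floorWeight_nonneg m₀]
    | succ M ih =>
      rw [Finset.sum_range_succ, show M + 1 + m₀ = M + m₀ + 1 by ring]
      have h1 := floorWeight_succ_le (show 1 ≤ M + m₀ by omega)
      have h2 : |s (M + m₀ + 1) * (floorWeight (M + m₀) - floorWeight (M + m₀ + 1))| ≤
          1 / 2 * (floorWeight (M + m₀) - floorWeight (M + m₀ + 1)) := by
        rw [abs_mul, abs_of_nonneg (sub_nonneg.2 h1)]
        exact mul_le_mul_of_nonneg_right (hsb _) (sub_nonneg.2 h1)
      rw [show ∀ a b c d e : ℝ, a + (b - c) * d + c * e = (a + b * d) - c * (d - e) by intros; ring]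
      refine (abs_sub _ _).trans ?_
      linarith
  have key2 : ∀ M, |∑ i ∈ Finset.range M, multipleIndicator d (i + m₀) * floorWeight (i + m₀) -
      1 / (d : ℝ) * (1 / m₀ - 1 / ((M + m₀ : ℕ) : ℝ))| ≤ floorWeight m₀ := by
    intro M
    have e : ∑ i ∈ Finset.range M, multipleIndicator d (i + m₀) * floorWeight (i + m₀) -
        1 / (d : ℝ) * (1 / m₀ - 1 / ((M + m₀ : ℕ) : ℝ)) =
        (∑ i ∈ Finset.range M, (s (i + m₀) - s (i + m₀ + 1)) * floorWeight (i + m₀) +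
          s (M + m₀) * floorWeight (M + m₀)) - s (M + m₀) * floorWeight (M + m₀) := by
      rw [← sum_floorWeight hm, Finset.mul_sum, ← Finset.sum_sub_distrib, add_sub_cancel_right]
      refine Finset.sum_congr rfl fun i _ => ?_
      rw [hind _ (by omega)]
      ring
    rw [e]
    refine (abs_sub _ _).trans ?_
    have h2 : |s (M + m₀) * floorWeight (M + m₀)| ≤ 1 / 2 * floorWeight (M + m₀) := by
      rw [abs_mul, abs_of_nonneg (floorWeight_nonneg _)]
      exact mul_le_mul_of_nonneg_right (hsb _) (floorWeight_nonneg _)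
    linarith [key M]
  have hl1 := hs.hasSum.tendsto_sum_nat
  have hl2 : Tendsto (fun M : ℕ => 1 / ((M + m₀ : ℕ) : ℝ)) atTop (nhds 0) :=
    tendsto_one_div_atTop_nhds_zero_nat.comp (tendsto_add_atTop_nat m₀)
  have hl3 := (hl1.sub ((tendsto_const_nhds (x := 1 / (m₀ : ℝ))).sub hl2 |>.const_mul
    (1 / (d : ℝ)))).abs
  rw [sub_zero] at hl3
  exact le_of_tendsto hl3 (Eventually.of_forall key2)

lemma sum_multipleIndicator_mul {d : ℕ} (hd : 1 ≤ d) {m₀ : ℕ} (hm : 1 ≤ m₀) (F : ℕ → ℝ) :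
    ∑ m ∈ Finset.Ico 1 m₀, multipleIndicator d m * F m =
      ∑ k ∈ Finset.Ico 1 ((m₀ - 1) / d + 1), F (d * k) := by
  simp only [multipleIndicator, ite_mul, one_mul, zero_mul]
  rw [← Finset.sum_filter]
  symm
  refine Finset.sum_bij (fun k _ => d * k) ?_ ?_ ?_ ?_
  · intro k hk
    rw [Finset.mem_Ico] at hk
    have h1 : k * d ≤ m₀ - 1 := (Nat.le_div_iff_mul_le hd).1 (by omega)
    simp only [Finset.mem_filter, Finset.mem_Ico, dvd_mul_right, and_true]
    rw [mul_comm] at h1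
    have : 1 ≤ d * k := Nat.mul_pos hd hk.1
    omega
  · intro k _ k' _ h
    exact Nat.eq_of_mul_eq_mul_left hd h
  · intro m hm'
    simp only [Finset.mem_filter, Finset.mem_Ico] at hm'
    obtain ⟨⟨h1, h2⟩, k, rfl⟩ := hm'
    refine ⟨k, ?_, rfl⟩
    have h3 : k ≤ (m₀ - 1) / d := (Nat.le_div_iff_mul_le hd).2 (by rw [mul_comm]; omega)
    have h4 : k ≠ 0 := by
      rintro rfl
      omega
    simp only [Finset.mem_Ico]
    omega
  · intro k _
    rfl

lemma one_le_log {x : ℝ} (hx : 4 ≤ x) : 1 ≤ Real.log x := by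
  rw [Real.le_log_iff_exp_le (by linarith)]
  linarith [Real.exp_one_lt_d9]

lemma clog_le_mul_log {x : ℝ} (hx : 4 ≤ x) {M : ℕ} (hM : (M : ℝ) ≤ x) :
    (Nat.clog 2 M : ℝ) ≤ 3 * Real.log x := by
  have hl := one_le_log hx
  set j := ⌈Real.logb 2 x⌉₊ with hj
  have h1 : Nat.clog 2 M ≤ j := by
    apply Nat.clog_le_of_le_pow
    have : (M : ℝ) ≤ (2 : ℝ) ^ j := by
      calc (M : ℝ) ≤ x := hM
        _ = (2 : ℝ) ^ Real.logb 2 x :=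
          (Real.rpow_logb (by norm_num) (by norm_num) (by linarith)).symm
        _ ≤ (2 : ℝ) ^ (j : ℝ) := Real.rpow_le_rpow_of_exponent_le (by norm_num) (Nat.le_ceil _)
        _ = _ := Real.rpow_natCast _ _
    exact_mod_cast this
  have h2 : (j : ℝ) < Real.logb 2 x + 1 := by
    apply Nat.ceil_lt_add_one
    exact Real.logb_nonneg (by norm_num) (by linarith)
  have h3 : Real.logb 2 x ≤ 2 * Real.log x := by
    rw [Real.logb, div_le_iff₀ (Real.log_pos (by norm_num))]
    have := Real.log_two_gt_d9
    nlinarith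
  have h4 : (Nat.clog 2 M : ℝ) ≤ j := by exact_mod_cast h1
  linarith

lemma abs_sum_sawtooth_div_natCast_le {x z θ c : ℝ} (hx : 4 ≤ x) {d : ℕ} (hd : 1 ≤ d) (hz : 0 < z)
    (hzx : z ^ 3 = x / d) (h0 : 0 ≤ θ) (h1 : θ ≤ 1) {M : ℕ} (hM : (M : ℝ) ≤ 2 * √x) :
    |∑ n ∈ Finset.Ico 1 M, sawtooth (x / d / ((n : ℝ) + θ) + c)| ≤
      66000 * Real.log x * (z + √(√x * d)) := by
  have hx0 : 0 < x := by linarith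
  have hd' : (0 : ℝ) < d := by exact_mod_cast hd
  have hl := one_le_log hx
  refine (abs_sum_sawtooth_div_le hz hzx h0 h1 M).trans ?_
  -- As `M ≤ 2√x`, the quantity under the root is at most `8 √x d`.
  have e1 : √((M : ℝ) ^ 3 / (x / d)) ≤ 3 * √(√x * d) := by
    have : 3 * √(√x * d) = √(9 * (√x * d)) := by
      rw [show (9 : ℝ) = 3 ^ 2 by norm_num, Real.sqrt_mul (sq_nonneg 3), Real.sqrt_sq (by norm_num)]
    rw [this]
    apply Real.sqrt_le_sqrt
    calc (M : ℝ) ^ 3 / (x / d) ≤ (2 * √x) ^ 3 / (x / d) := by gcongr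
      _ = 8 * (√x * d) * (√x * √x / x) := by field_simp; ring
      _ = 8 * (√x * d) := by rw [Real.mul_self_sqrt hx0.le, div_self hx0.ne', mul_one]
      _ ≤ _ := by gcongr; norm_num
  have e2 := clog_le_mul_log hx (hM.trans (ceil_sqrt_bounds hx).2.2.2.1)
  calc _ ≤ 3 * Real.log x * (7300 * (z + 3 * √(√x * d))) := by gcongr
    _ ≤ _ := by
      have := Real.sqrt_nonneg (√x * d)
      have : 0 ≤ Real.log x * z := by positivity
      have : 0 ≤ Real.log x * √(√x * d) := by positivity
      nlinarith

theorem abs_floorSumError_multipleIndicator_le {x z : ℝ} (hx : 4 ≤ x) {d : ℕ} (hd : 1 ≤ d)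
    (hz : 0 < z) (hzx : z ^ 3 = x / d) :
    |floorSumError x (multipleIndicator d)| ≤ 270000 * Real.log x * (z + √(√x * d)) := by
  obtain ⟨h1, h2, h3, h4, h5, h6⟩ := ceil_sqrt_bounds hx
  set m₀ := ⌈√x⌉₊
  set N := ⌊x / m₀⌋₊ with hN
  have hx0 : 0 < x := by linarith
  have hl := one_le_log hx
  have hm0 : (0 : ℝ) < m₀ := by linarith
  have hd' : (1 : ℝ) ≤ d := by exact_mod_cast hd
  have hd0 : (0 : ℝ) < d := by linarith
  have hbd : ∀ m, 1 ≤ m → |multipleIndicator d m| ≤ 1 * (1 + Real.log m) := fun m _ => by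
    have := abs_multipleIndicator_le d m
    have := Real.log_natCast_nonneg m
    linarith
  rw [floorSumError_eq hx0.le (summable_of_le_log zero_le_one hbd) h3]
  set R := 66000 * Real.log x * (z + √(√x * d)) with hR
  have hK : (((m₀ - 1) / d + 1 : ℕ) : ℝ) ≤ 2 * √x := by
    have : (m₀ - 1) / d + 1 ≤ m₀ := by
      have := Nat.div_le_self (m₀ - 1) d
      omega
    exact le_trans (by exact_mod_cast this) h2
  have hN' : ((N + 1 : ℕ) : ℝ) ≤ 2 * √x := by
    push_cast
    linarith
  -- With `m = d k` one has `x / (m + 1) = (x / d) / (k + 1 / d)`, which is why the shift `θ` is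
  -- allowed.
  have a1 : |∑ m ∈ Finset.Ico 1 m₀, multipleIndicator d m * sawtooth (x / ((m : ℝ) + 1))| ≤ R := by
    rw [sum_multipleIndicator_mul hd h3 (fun m => sawtooth (x / ((m : ℝ) + 1)))]
    have := abs_sum_sawtooth_div_natCast_le (θ := 1 / d) (c := 0) hx hd hz hzx (by positivity)
      (by rw [div_le_one hd0]; exact hd') hK
    refine (congrArg abs (Finset.sum_congr rfl fun k _ => ?_)).trans_le this
    push_cast
    rw [add_zero, div_div, mul_add, mul_one_div_cancel hd0.ne']
  have a2 : |∑ m ∈ Finset.Ico 1 m₀, multipleIndicator d m * sawtooth (x / m)| ≤ R := by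
    rw [sum_multipleIndicator_mul hd h3 (fun m => sawtooth (x / m))]
    have := abs_sum_sawtooth_div_natCast_le (c := 0) hx hd hz hzx le_rfl zero_le_one hK
    refine (congrArg abs (Finset.sum_congr rfl fun k _ => ?_)).trans_le this
    push_cast
    rw [add_zero, add_zero, div_div]
  have a3 := abs_sum_sawtooth_div_natCast_le (c := 0) hx hd hz hzx le_rfl zero_le_one hN'
  have a4 := abs_sum_sawtooth_div_natCast_le (c := -(1 / d)) hx hd hz hzx le_rfl zero_le_one hN'
  have hB : ∑ n ∈ Finset.Ico 1 (N + 1), multipleIndicator d ⌊x / (n : ℝ)⌋₊ =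
      N / d - ∑ n ∈ Finset.Ico 1 (N + 1), sawtooth (x / d / ((n : ℝ) + 0) + 0) +
        ∑ n ∈ Finset.Ico 1 (N + 1), sawtooth (x / d / ((n : ℝ) + 0) + -(1 / d)) := by
    have e : (N : ℝ) / d = ∑ n ∈ Finset.Ico 1 (N + 1), (1 / d : ℝ) := by
      rw [Finset.sum_const, Nat.card_Ico, nsmul_eq_mul, Nat.add_sub_cancel]
      ring
    rw [e, ← Finset.sum_sub_distrib, ← Finset.sum_add_distrib]
    refine Finset.sum_congr rfl fun n hn => ?_
    rw [Finset.mem_Ico] at hn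
    have hn1 : (1 : ℝ) ≤ n := by exact_mod_cast hn.1
    have hn2 : (n : ℝ) ≤ √x := by
      have : (n : ℝ) ≤ N := by exact_mod_cast (by omega : n ≤ N)
      linarith
    rw [multipleIndicator_floor (by rw [le_div_iff₀ (by linarith)]; linarith)]
    congr 2
    · congr 1
      rw [add_zero, add_zero]
      field_simp
    · rw [add_zero, sub_div]
      field_simp
      ring
  have hT := abs_tsum_multipleIndicator_sub_le d h3
    (summable_tail_of_le_log zero_le_one hbd h3).1
  set T := ∑' i, multipleIndicator d (i + m₀) * floorWeight (i + m₀)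
  have hxT : |x * T - x / m₀ / d| ≤ 1 := by
    have : x * T - x / m₀ / d = x * (T - 1 / (d : ℝ) * (1 / m₀)) := by
      field_simp
    rw [this, abs_mul, abs_of_pos hx0]
    refine (mul_le_mul_of_nonneg_left hT hx0.le).trans ?_
    unfold floorWeight
    rw [mul_one_div, div_le_one (by positivity)]
    nlinarith [Real.mul_self_sqrt hx0.le]
  have hNx : |(N : ℝ) / d - x / m₀ / d| ≤ 1 := by
    have e1 := Nat.floor_le (show 0 ≤ x / m₀ by positivity)
    have e2 := Nat.lt_floor_add_one (x / m₀)
    rw [← sub_div, abs_div, abs_of_pos hd0, div_le_one hd0, abs_le]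
    constructor <;> linarith
  rw [hB]
  simp only [mul_sub, Finset.sum_sub_distrib]
  have hsq : 1 ≤ √(√x * d) := by
    rw [Real.one_le_sqrt]
    nlinarith
  have hlz : 0 < Real.log x * z := by positivity
  have hls : 1 ≤ Real.log x * √(√x * d) := by nlinarith
  -- Four sawtooth sums of size `R`, plus an error of at most `2` from comparing `N / d` with `x *
  -- T`.
  rw [abs_le] at *
  constructor <;> linarith

/-! ### Decomposition over primes and the final estimate. -/

lemma floorSumError_add {x : ℝ} {f g : ℕ → ℝ} (hf : Summable fun m => f m * floorWeight m)
    (hg : Summable fun m => g m * floorWeight m) :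
    floorSumError x (fun m => f m + g m) = floorSumError x f + floorSumError x g := by
  unfold floorSumError
  simp only [add_mul]
  rw [Finset.sum_add_distrib, hf.tsum_add hg]
  ring

lemma floorSumError_sum_mul {x : ℝ} (s : Finset ℕ) (a : ℕ → ℝ) {f : ℕ → ℕ → ℝ}
    (hf : ∀ p, Summable fun m => f p m * floorWeight m) :
    floorSumError x (fun m => ∑ p ∈ s, a p * f p m) = ∑ p ∈ s, a p * floorSumError x (f p) := by
  unfold floorSumError
  simp only [Finset.sum_mul, mul_assoc]
  rw [Summable.tsum_finsetSum fun p _ => (hf p).mul_left (a p), Finset.sum_comm, Finset.mul_sum,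
    ← Finset.sum_sub_distrib]
  refine Finset.sum_congr rfl fun p _ => ?_
  rw [tsum_mul_left, ← Finset.mul_sum]
  ring

lemma idConvPrime_div_eq {m : ℕ} (hm : 1 ≤ m) :
    idConvPrime m / m = ∑ p ∈ m.primeFactors, 1 / (p : ℝ) := by
  have hm0 : (m : ℝ) ≠ 0 := by exact_mod_cast (by omega : m ≠ 0)
  rw [idConvPrime, ArithmeticFunction.mul_apply,
    Nat.sum_divisorsAntidiagonal' (fun a b => ((ArithmeticFunction.id : ArithmeticFunction ℝ) a) *
      primeIndicator b), Nat.primeFactors_eq_to_filter_divisors_prime, Finset.sum_filter,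
    Finset.sum_div]
  refine Finset.sum_congr rfl fun p hp => ?_
  have hpm := Nat.dvd_of_mem_divisors hp
  have hp0 : (p : ℝ) ≠ 0 := by exact_mod_cast (Nat.pos_of_dvd_of_pos hpm hm).ne'
  have h1 : primeIndicator p = if p.Prime then 1 else 0 := by
    simp only [primeIndicator, ArithmeticFunction.coe_mk]
  rw [ArithmeticFunction.natCoe_apply, ArithmeticFunction.id_apply, Nat.cast_div hpm hp0, h1]
  split_ifs
  · field_simp
  · simp

/-- The product of the distinct primes dividing `m` is at most `m`, and each is at least `2`. -/
lemma card_primeFactors_le {m : ℕ} (hm : 1 ≤ m) :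
    (m.primeFactors.card : ℝ) ≤ 2 * (1 + Real.log m) := by
  have h1 : 2 ^ m.primeFactors.card ≤ m :=
    (Finset.pow_card_le_prod _ _ _ fun p hp => (Nat.prime_of_mem_primeFactors hp).two_le).trans
      (Nat.le_of_dvd hm (Nat.prod_primeFactors_dvd m))
  have h2 : (2 : ℝ) ^ m.primeFactors.card ≤ m := by exact_mod_cast h1
  have h3 := Real.log_le_log (by positivity) h2
  rw [Real.log_pow] at h3
  have h4 := Real.log_two_gt_d9
  have h5 : (0 : ℝ) ≤ m.primeFactors.card := by positivity
  nlinarith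

lemma sum_prime_multipleIndicator {m : ℕ} (hm : 1 ≤ m) (D : ℕ) :
    ∑ p ∈ (Finset.Icc 1 D).filter Nat.Prime, 1 / (p : ℝ) * multipleIndicator p m =
      ∑ p ∈ m.primeFactors.filter (· ≤ D), 1 / (p : ℝ) := by
  simp only [multipleIndicator, mul_ite, mul_one, mul_zero]
  rw [← Finset.sum_filter]
  congr 1
  ext p
  simp only [Finset.mem_filter, Finset.mem_Icc, Nat.mem_primeFactors]
  constructor
  · rintro ⟨⟨⟨_, h1⟩, h2⟩, h3⟩
    exact ⟨⟨h2, h3, by omega⟩, h1⟩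
  · rintro ⟨⟨h2, h3, _⟩, h1⟩
    exact ⟨⟨⟨h2.one_le, h1⟩, h2⟩, h3⟩

/-- Only prime factors above `D` survive; each contributes at most `1 / Y`, and there are `O(1 + log
m)` of them. -/
lemma abs_idConvPrime_div_sub_le {Y : ℝ} (hY : 0 < Y) {D : ℕ} (hD : ∀ p : ℕ, D < p → Y ≤ p) {m : ℕ}
    (hm : 1 ≤ m) :
    |idConvPrime m / m -
      ∑ p ∈ (Finset.Icc 1 D).filter Nat.Prime, 1 / (p : ℝ) * multipleIndicator p m| ≤
      2 / Y * (1 + Real.log m) := by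
  rw [idConvPrime_div_eq hm, sum_prime_multipleIndicator hm,
    ← Finset.sum_filter_add_sum_filter_not m.primeFactors (· ≤ D), add_sub_cancel_left,
    abs_of_nonneg (Finset.sum_nonneg fun p _ => by positivity)]
  calc _ ≤ ∑ p ∈ m.primeFactors.filter (fun p => ¬ p ≤ D), 1 / Y := by
        refine Finset.sum_le_sum fun p hp => ?_
        exact one_div_le_one_div_of_le hY (hD p (not_le.1 (Finset.mem_filter.1 hp).2))
    _ ≤ m.primeFactors.card * (1 / Y) := by
        rw [Finset.sum_const, nsmul_eq_mul]
        gcongr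
        exact Finset.filter_subset _ _
    _ ≤ 2 * (1 + Real.log m) * (1 / Y) := by
        gcongr
        exact card_primeFactors_le hm
    _ = _ := by ring

lemma summable_idConvPrime_mul_floorWeight :
    Summable fun m : ℕ => idConvPrime m / m * floorWeight m := by
  -- With `D = 0` and `Y = 1` the truncated sum is empty.
  refine summable_of_le_log (B := 2 / 1) (by norm_num) fun m hm => ?_
  have := abs_idConvPrime_div_sub_le one_pos (D := 0)
    (fun p hp => by exact_mod_cast hp) hm
  simpa using this

lemma summable_multipleIndicator_mul_floorWeight (d : ℕ) :
    Summable fun m : ℕ => multipleIndicator d m * floorWeight m :=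
  summable_of_le_log zero_le_one fun m _ => by
    have := abs_multipleIndicator_le d m
    have := Real.log_natCast_nonneg m
    linarith

lemma idConvPrime_term_eq (m : ℕ) :
    idConvPrime m / ((m : ℝ) ^ 2 * ((m : ℝ) + 1)) = idConvPrime m / m * floorWeight m := by
  rw [floorWeight, div_mul_div_comm, mul_one]
  ring_nf

lemma floorSumError_idConvPrime_eq (x : ℝ) :
    (∑ n ∈ Finset.Icc 1 ⌊x⌋₊, idConvPrime ⌊x / (n : ℝ)⌋₊ / (⌊x / (n : ℝ)⌋₊ : ℝ)) -
      x * ∑' m : ℕ+, idConvPrime m / ((m : ℝ) ^ 2 * ((m : ℝ) + 1)) =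
    floorSumError x (fun m => idConvPrime m / m) := by
  have h : ∑' m : ℕ+, idConvPrime m / ((m : ℝ) ^ 2 * ((m : ℝ) + 1)) =
      ∑' m : ℕ, idConvPrime m / m * floorWeight m := by
    rw [← PNat.coe_injective.tsum_eq (f := fun m : ℕ => idConvPrime m / m * floorWeight m)]
    · exact tsum_congr fun m => idConvPrime_term_eq m
    · intro m hm
      have : m ≠ 0 := by
        rintro rfl
        simp [floorWeight_zero] at hm
      exact ⟨⟨m, Nat.pos_of_ne_zero this⟩, rfl⟩
  rw [h, floorSumError]

lemma sum_prime_inv_mul_rpow_le (D : ℕ) :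
    ∑ p ∈ (Finset.Icc 1 D).filter Nat.Prime, 1 / (p : ℝ) * (p : ℝ) ^ (-(1 / 3) : ℝ) ≤
      ∑' n : ℕ, (n : ℝ) ^ (-(4 / 3) : ℝ) := by
  have hs : Summable fun n : ℕ => (n : ℝ) ^ (-(4 / 3) : ℝ) :=
    Real.summable_nat_rpow.2 (by norm_num)
  refine le_trans (le_of_eq (Finset.sum_congr rfl fun p hp => ?_))
    (hs.sum_le_tsum _ fun n _ => by positivity)
  have hp0 : (0 : ℝ) < p := by exact_mod_cast (Finset.mem_filter.1 hp).2.pos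
  rw [one_div, ← Real.rpow_neg_one, ← Real.rpow_add hp0]
  norm_num

lemma sum_prime_inv_mul_sqrt_le (a : ℝ) (ha : 0 ≤ a) (D : ℕ) :
    ∑ p ∈ (Finset.Icc 1 D).filter Nat.Prime, 1 / (p : ℝ) * √(a * p) ≤ √a * (2 * √D) := by
  calc _ ≤ ∑ p ∈ Finset.Icc 1 D, 1 / (p : ℝ) * √(a * p) :=
        Finset.sum_le_sum_of_subset_of_nonneg (Finset.filter_subset _ _)
          fun p _ _ => by positivity
    _ = ∑ h ∈ Finset.range D, √a * (1 / √((h : ℝ) + 1)) := by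
        rw [show Finset.Icc 1 D = Finset.Ico 1 (D + 1) by rfl, Finset.sum_Ico_eq_sum_range,
          Nat.add_sub_cancel]
        refine Finset.sum_congr rfl fun h _ => ?_
        rw [show ((1 + h : ℕ) : ℝ) = (h : ℝ) + 1 by push_cast; ring, Real.sqrt_mul ha]
        have h1 : √((h : ℝ) + 1) * √((h : ℝ) + 1) = (h : ℝ) + 1 :=
          Real.mul_self_sqrt (by positivity)
        have h2 : 0 < √((h : ℝ) + 1) := by positivity
        nth_rewrite 1 [← h1]
        field_simp
    _ ≤ _ := by
        rw [← Finset.mul_sum]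
        gcongr
        exact sum_inv_sqrt_le D

theorem abs_floorSumError_idConvPrime_le {x : ℝ} (hx : 4 ≤ x) :
    |floorSumError x (fun m => idConvPrime m / m)| ≤
      (270000 * (∑' n : ℕ, (n : ℝ) ^ (-(4 / 3) : ℝ) + 2) + 30) *
        (x ^ ((1 : ℝ) / 3) * Real.log x) := by
  have hx0 : 0 < x := by linarith
  have hl := one_le_log hx
  set C := ∑' n : ℕ, (n : ℝ) ^ (-(4 / 3) : ℝ) with hC
  set X := x ^ ((1 : ℝ) / 3) with hX
  have hX0 : 0 < X := by positivity
  -- The cut where the large-prime loss `√x / Y` equals the small-prime term `x^{1/4} √Y`; both are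
  -- then `x^{1/3}`, see `hXY` and `hXY'`.
  set Y := x ^ ((1 : ℝ) / 6) with hY
  have hY0 : 0 < Y := by positivity
  set D := ⌊Y⌋₊ with hD
  have hDY : ∀ p : ℕ, D < p → Y ≤ p := fun p hp => ((Nat.floor_lt hY0.le).1 hp).le
  set s := (Finset.Icc 1 D).filter Nat.Prime
  set r : ℕ → ℝ := fun m => idConvPrime m / m - ∑ p ∈ s, 1 / (p : ℝ) * multipleIndicator p m
    with hr
  have hrb : ∀ m, 1 ≤ m → |r m| ≤ 2 / Y * (1 + Real.log m) := fun m hm =>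
    abs_idConvPrime_div_sub_le hY0 hDY hm
  have hsplit : (fun m : ℕ => idConvPrime m / m) =
      fun m => ∑ p ∈ s, 1 / (p : ℝ) * multipleIndicator p m + r m := by
    funext m
    simp only [hr]
    ring
  have hsum : Summable fun m => (∑ p ∈ s, 1 / (p : ℝ) * multipleIndicator p m) * floorWeight m := by
    simp only [Finset.sum_mul, mul_assoc]
    exact summable_sum fun p _ => (summable_multipleIndicator_mul_floorWeight p).mul_left _
  rw [hsplit, floorSumError_add hsum (summable_of_le_log (by positivity) hrb),
    floorSumError_sum_mul s _ summable_multipleIndicator_mul_floorWeight]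
  have hXY : √x / Y = X := by
    rw [Real.sqrt_eq_rpow, hY, ← Real.rpow_sub hx0, hX]
    norm_num
  have hXY' : √(√x) * √Y = X := by
    rw [Real.sqrt_eq_rpow, Real.sqrt_eq_rpow, Real.sqrt_eq_rpow, hY, ← Real.rpow_mul hx0.le,
      ← Real.rpow_mul hx0.le, ← Real.rpow_add hx0, hX]
    norm_num
  have b1 : |∑ p ∈ s, 1 / (p : ℝ) * floorSumError x (multipleIndicator p)| ≤
      270000 * Real.log x * (X * C + 2 * X) := by
    calc _ ≤ ∑ p ∈ s, 270000 * Real.log x * (X * (1 / (p : ℝ) * (p : ℝ) ^ (-(1 / 3) : ℝ)) +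
          1 / (p : ℝ) * √(√x * p)) := by
          refine (Finset.abs_sum_le_sum_abs _ _).trans (Finset.sum_le_sum fun p hp => ?_)
          have hp1 : 1 ≤ p := (Finset.mem_filter.1 hp).2.one_le
          have hp0 : (0 : ℝ) < p := by exact_mod_cast hp1
          have hz : (X * (p : ℝ) ^ (-(1 / 3) : ℝ)) ^ 3 = x / p := by
            rw [mul_pow, hX, ← Real.rpow_natCast, ← Real.rpow_mul hx0.le, ← Real.rpow_natCast,
              ← Real.rpow_mul hp0.le]
            norm_num
            rw [Real.rpow_neg_one, div_eq_mul_inv]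
          have := abs_floorSumError_multipleIndicator_le hx hp1 (by positivity) hz
          rw [abs_mul, abs_of_pos (by positivity : 0 < 1 / (p : ℝ))]
          refine (mul_le_mul_of_nonneg_left this (by positivity)).trans (le_of_eq ?_)
          ring
      _ = 270000 * Real.log x * (X * (∑ p ∈ s, 1 / (p : ℝ) * (p : ℝ) ^ (-(1 / 3) : ℝ)) +
          ∑ p ∈ s, 1 / (p : ℝ) * √(√x * p)) := by
          rw [← Finset.mul_sum, Finset.sum_add_distrib, ← Finset.mul_sum]
      _ ≤ _ := by
          have e1 := sum_prime_inv_mul_rpow_le D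
          have e2 := sum_prime_inv_mul_sqrt_le (√x) (Real.sqrt_nonneg x) D
          have e3 : √(√x) * (2 * √D) ≤ 2 * X := by
            rw [← hXY']
            have : √(D : ℝ) ≤ √Y := Real.sqrt_le_sqrt (Nat.floor_le hY0.le)
            nlinarith [Real.sqrt_nonneg (√x)]
          gcongr
          exact e2.trans e3
  have b2 : |floorSumError x r| ≤ 30 * (X * Real.log x) := by
    refine (abs_floorSumError_le hx (by positivity) hrb).trans ?_
    rw [show 5 * (2 / Y) * √x * (2 + Real.log x) = 10 * (√x / Y) * (2 + Real.log x) by ring, hXY]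
    nlinarith
  refine (abs_add_le _ _).trans ((add_le_add b1 b2).trans (le_of_eq ?_))
  ring

theorem mainTheorem4 :
    Summable (fun m : ℕ+ => idConvPrime m / ((m : ℝ) ^ 2 * ((m : ℝ) + 1))) ∧
    (fun x : ℝ =>
        (∑ n ∈ Finset.Icc 1 ⌊x⌋₊, idConvPrime ⌊x / (n : ℝ)⌋₊ / (⌊x / (n : ℝ)⌋₊ : ℝ)) -
          x * ∑' m : ℕ+, idConvPrime m / ((m : ℝ) ^ 2 * ((m : ℝ) + 1)))
      =O[atTop] (fun x : ℝ => x ^ ((1 : ℝ) / 3) * Real.log x) := by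
  refine ⟨?_, ?_⟩
  · refine (summable_idConvPrime_mul_floorWeight.comp_injective PNat.coe_injective).congr
      fun m => ?_
    exact (idConvPrime_term_eq m).symm
  · refine IsBigO.of_bound (270000 * (∑' n : ℕ, (n : ℝ) ^ (-(4 / 3) : ℝ) + 2) + 30)
      ((eventually_ge_atTop 4).mono fun x hx => ?_)
    have hl := one_le_log hx
    rw [floorSumError_idConvPrime_eq, Real.norm_eq_abs, Real.norm_eq_abs,
      abs_of_nonneg (a := x ^ ((1 : ℝ) / 3) * Real.log x)
        (mul_nonneg (Real.rpow_nonneg (by linarith) _) (by linarith))]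
    exact abs_floorSumError_idConvPrime_le hx
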